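/- Let $n\ge 1$, $R>0$, $B_R=\{x\in\mathbb R^n:|x|<R\}$, and let $f:\mathbb R^n\to\mathbb R$ be of class $C^1$ on $\mathbb R^n\setminus\{0\}$ (in particular, $f$ may be $C^1$ on all of $\mathbb R^n$). Let $u\in C^1(B_R)\cap C^3(B_R\cap\{|\nabla u|>0\})$ be a solution of $$\operatorname{div}\!\left(\frac{\nabla u}{\sqrt{1+|\nabla u|^2}}\right)=f(\nabla u),$$ where the equation is required to hold classically at every point of $B_R$ with $|\nabla u|>0$. Put $L:=\sup_{x,y\in B_R}|u(x)-u(y)|$; in (c), (d) and (e) assume $L<\infty$ (otherwise the bound is void). Consider the following conditions, to hold for all $p\in\mathbb R^n\setminus\{0\}$, in which all $m_i$ are positive constants: - (A1) $f(p)^2-m_1|p|^2|\nabla_pf(p)|^2\ge m_2|p|^{2\theta}$; - (A2) $f(p)^2-m_1(1+|p|^2)\log(1+|p|^2)|\nabla_pf(p)|^2\ge m_2\log^{2\theta}(1+|p|^2)$ and $|f(p)|\le m_3\log^{\theta}(1+|p|^2)$; - (A3) $|f(p)|=m_1\log^{\theta}(1+|p|^2)$; - (A4) $f(p)^2-m_1(1+|p|^2)^2\log(1+|p|^2)|\nabla_pf(p)|^2\ge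 0$ and $|f(p)|\le m_2$. Then: (a) If $\theta>0$ and $f$ satisfies (A1), then $$|\nabla u(0)|\le \frac{C}{R^{1/\theta}},$$ where $C>0$ depends only on $n,m_1,m_2,\theta$. (b) If $\theta>1$ and $f$ satisfies (A2), then $$|\nabla u(0)|^2\le\max\left\{\exp\left(\frac{C}{R^{1/(\theta-1)}}\right)-1,\ \frac{C}{R^{2/(2\theta-1)}}\right\},$$ where $C>0$ depends only on $n,m_1,m_2,m_3,\theta$. (c) If $0<\theta\le1$ and $f$ satisfies (A3), then for every $0<\eta<1$ $$|\nabla u(0)|^2\le\max\left\{\exp\left(\frac{C_1(L+1)^{1/(2\theta)}}{R^{1/\theta}}\right)-1,\ \exp\left(\frac{C_2(L+1)^{1/(1-\eta)}}{R^{2/(1-\eta)}}\right)-1\right\},$$ where $C_1>0$ depends only on $n,m_1,\theta$ and $C_2>0$ only on $n,m_1,\eta,\theta$. (d) If $f$ satisfies (A4), then $$|\nabla u(0)|^2\le\max\left\{\exp\left(\frac{C(L+1)^2}{R^2}\right)-1,\ \exp\left(\frac{C(L+1)^2}{R^{2/3}}\right)-1\right\},$$ where $C>0$ depends only on $n,m_1,m_2$.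 (e) If $f\equiv0$, then $$|\nabla u(0)|^2\le\max\left\{\exp\left(\frac{CL^2}{R^2}\right)-1,\ \exp\left(\frac{CL}{R}\right)-1\right\},$$ where $C>0$ depends only on $n$. -/

import Mathlib

/-- Euclidean space `ℝⁿ`. -/
abbrev En (n : ℕ) : Type := EuclideanSpace ℝ (Fin n)

noncomputable section

/-- The open ball `B_R(0)`. -/
def ballR (n : ℕ) (R : ℝ) : Set (En n) := Metric.ball 0 R

/-- The divergence `∑ᵢ ∂ᵢ Vᵢ` of a vector field on `ℝⁿ`. -/
def divergence {n : ℕ} (V : En n → En n) (x : En n) : ℝ :=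
  ∑ i : Fin n, (fderiv ℝ V x (EuclideanSpace.single i 1)) i

/-- The mean curvature operator `div (∇u / √(1 + |∇u|²))`. -/
def meanCurvatureOp {n : ℕ} (u : En n → ℝ) (x : En n) : ℝ :=
  divergence (fun y => (Real.sqrt (1 + ‖gradient u y‖ ^ 2))⁻¹ • gradient u y) x

/-- The part of the ball `B_R(0)` on which `|∇u| > 0`. -/
def noncriticalSet {n : ℕ} (u : En n → ℝ) (R : ℝ) : Set (En n) :=
  {x | x ∈ ballR n R ∧ 0 < ‖gradient u x‖}

/-- `u ∈ C¹(B_R) ∩ C³(B_R ∩ {|∇u| > 0})` solves `div (∇u / √(1 + |∇u|²)) = f(∇u)`.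
At critical points `u` need not be twice differentiable, and the equation is required only where it
has a classical meaning, i.e. where `|∇u| > 0`; every stronger notion of solution (such as a
distributional solution in `B_R` with this regularity) satisfies this. -/
structure IsSolution {n : ℕ} (f : En n → ℝ) (u : En n → ℝ) (R : ℝ) : Prop where
  contDiffOn_one : ContDiffOn ℝ 1 u (ballR n R)
  contDiffOn_three : ContDiffOn ℝ 3 u (noncriticalSet u R)
  equation : ∀ x ∈ noncriticalSet u R, meanCurvatureOp u x = f (gradient u x)

/-- The set of all `|u(x) - u(y)|` with `x, y ∈ B_R(0)`; its supremum is the oscillation `L`. -/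
def oscillationSet {n : ℕ} (u : En n → ℝ) (R : ℝ) : Set ℝ :=
  {t | ∃ x ∈ ballR n R, ∃ y ∈ ballR n R, t = |u x - u y|}

/-- `f` is of class `C¹` away from the origin. (The nonlinearities of interest, such as `|p|^θ` with
`θ ≤ 1`, `log^θ(1 + |p|²)` with `θ ≤ 1/2` and `|p| / √(1 + |p|²)`, are not differentiable at `0`;
a `C¹` function on all of `ℝⁿ` is a special case.) -/
def C1AwayFromZero {n : ℕ} (f : En n → ℝ) : Prop :=
  ContDiffOn ℝ 1 f {p | p ≠ 0}

/-- Structural condition of power type, with constants `m₁, m₂`. -/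
def CondA1 {n : ℕ} (θ m₁ m₂ : ℝ) (f : En n → ℝ) : Prop :=
  ∀ p : En n, p ≠ 0 →
    m₂ * ‖p‖ ^ (2 * θ) ≤ f p ^ 2 - m₁ * ‖p‖ ^ 2 * ‖gradient f p‖ ^ 2

/-- Structural condition of logarithmic type with `θ > 1`, with constants `m₁, m₂, m₃`. -/
def CondA2 {n : ℕ} (θ m₁ m₂ m₃ : ℝ) (f : En n → ℝ) : Prop :=
  ∀ p : En n, p ≠ 0 →
    m₂ * Real.log (1 + ‖p‖ ^ 2) ^ (2 * θ) ≤
        f p ^ 2 - m₁ * (1 + ‖p‖ ^ 2) * Real.log (1 + ‖p‖ ^ 2) * ‖gradient f p‖ ^ 2 ∧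
      |f p| ≤ m₃ * Real.log (1 + ‖p‖ ^ 2) ^ θ

/-- Exact logarithmic growth, with constant `m₁`. -/
def CondA3 {n : ℕ} (θ m₁ : ℝ) (f : En n → ℝ) : Prop :=
  ∀ p : En n, p ≠ 0 → |f p| = m₁ * Real.log (1 + ‖p‖ ^ 2) ^ θ

/-- Structural condition for bounded `f`, with constants `m₁, m₂`. -/
def CondA4 {n : ℕ} (m₁ m₂ : ℝ) (f : En n → ℝ) : Prop :=
  ∀ p : En n, p ≠ 0 →
    0 ≤ f p ^ 2 - m₁ * (1 + ‖p‖ ^ 2) ^ 2 * Real.log (1 + ‖p‖ ^ 2) * ‖gradient f p‖ ^ 2 ∧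
      |f p| ≤ m₂

end

/-! The proof is a Bernstein argument. On the ball of radius `R / 2` one maximises `η ^ k * Z
(|∇u|²) * exp (h (u))`, where `η` is a quadratic cutoff vanishing on the boundary and `Z 0 = 0`. The
maximum is therefore interior and noncritical, exactly where `u` is `C³` and `f` is differentiable.
At that point the logarithm has zero gradient and nonpositive Hessian, and the Hessian is traced
against `A = I - p pᵀ / (1 + |p|²)`, `p = ∇u`, the coefficient matrix of the equation in
nondivergence form. Differentiating the equation in the direction `p` removes the third derivatives.
The Hessian `H` of `u` then survives only through `H p`, which the first order condition determines,
and through `τ = tr (A H²)`. Since `(tr (A H))² ≤ n τ`, the equation bounds `τ` below by a multiple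
of `(1 + |p|²) f²`. All of this is `exists_bernstein_inequality`; `exists_point_log` and
`exists_point_log_log` specialise it to `Z s = s` and `Z s = log (1 + s)`.

For (a) and (b) take `h = 0`. The structural condition bounds `∇f` by `f`, leaving a quadratic
inequality with cutoff size `δ = (R η / 2)⁻¹`, so a power of `|p|` or of `log (1 + |p|²)` is at most
a constant times `δ`. The exponent `k` is chosen so that `η ^ k` compensates the blow-up of `δ` as
`η → 0`.

For (d) and (e) take `h = -β log φ` with `φ` equal to `u` plus a constant and comparable to the
oscillation. The positive term coming from `h''` absorbs the gradient terms when `β` is small, and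
what is left bounds `log (1 + |p|²)`; `log_bound_of_oscillation` covers both cases.

For (c) and `n ≥ 2`, `f` has a constant sign `σ`, and `φ` is built from `σ u`. The derivative of `f`
then produces a positive term of order `|f| √(1 + |p|²) / log (1 + |p|²)`, which is exponentially
large in `log (1 + |p|²)`; combined with the `f²` term by the arithmetic-geometric mean inequality
it gives the factor `√(L + 1)`. For `n = 1`, `f` may change sign across the origin, but there `H p`
determines `τ`, so the first order condition is enough. -/

/-! ### Linear algebra of the matrix `A = I - p pᵀ / (1 + |p|²)`. -/

noncomputable section GraphMetric

variable {ι E : Type*} [Fintype ι] [NormedAddCommGroup E]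

/-- The coefficient `c` for which `(I - c p pᵀ)² = I - p pᵀ / (1 + |p|²)`. -/
def rootCoeff (p : E) : ℝ := (√(1 + ‖p‖ ^ 2) * (√(1 + ‖p‖ ^ 2) + 1))⁻¹

lemma rootCoeff_spec (p : E) :
    2 * rootCoeff p - rootCoeff p ^ 2 * ‖p‖ ^ 2 = (1 + ‖p‖ ^ 2)⁻¹ := by
  have hs : √(1 + ‖p‖ ^ 2) ^ 2 = 1 + ‖p‖ ^ 2 := Real.sq_sqrt (by positivity)
  have h0 : 0 < √(1 + ‖p‖ ^ 2) := Real.sqrt_pos.2 (by positivity)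
  have hv : ‖p‖ ^ 2 = √(1 + ‖p‖ ^ 2) ^ 2 - 1 := by linarith
  unfold rootCoeff
  generalize √(1 + ‖p‖ ^ 2) = s at *
  rw [hv, show 1 + (s ^ 2 - 1) = s ^ 2 by ring]
  field_simp
  ring

variable [InnerProductSpace ℝ E]

/-- The quadratic form `⟨A a, a⟩` of the matrix `A = I - p pᵀ / (1 + |p|²)`. -/
def graphForm (p a : E) : ℝ := ‖a‖ ^ 2 - inner ℝ p a ^ 2 / (1 + ‖p‖ ^ 2)

/-- The trace of the quadratic form `q` with respect to `A = I - p pᵀ / (1 + |p|²)`. -/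
def graphTrace (b : OrthonormalBasis ι ℝ E) (p : E) (q : E → ℝ) : ℝ :=
  ∑ i, q (b i) - q p / (1 + ‖p‖ ^ 2)

/-- The symmetric square root `I - c p pᵀ` of `I - p pᵀ / (1 + |p|²)`. -/
def rootMap (p a : E) : E := a - (rootCoeff p * inner ℝ p a) • p

lemma inner_rootMap_rootMap (p a a' : E) :
    inner ℝ (rootMap p a) (rootMap p a') =
      inner ℝ a a' - inner ℝ p a * inner ℝ p a' / (1 + ‖p‖ ^ 2) := by
  have h := rootCoeff_spec p
  simp only [rootMap, inner_sub_left, inner_sub_right, real_inner_smul_left, real_inner_smul_right,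
    real_inner_self_eq_norm_sq, real_inner_comm p a]
  rw [div_eq_mul_inv, ← h]
  ring

lemma norm_rootMap_sq (p a : E) : ‖rootMap p a‖ ^ 2 = graphForm p a := by
  rw [← real_inner_self_eq_norm_sq, inner_rootMap_rootMap, real_inner_self_eq_norm_sq, graphForm]
  ring

lemma graphForm_nonneg (p a : E) : 0 ≤ graphForm p a := by
  rw [← norm_rootMap_sq]; positivity

lemma graphForm_le (p a : E) : graphForm p a ≤ ‖a‖ ^ 2 := by
  have : 0 ≤ inner ℝ p a ^ 2 / (1 + ‖p‖ ^ 2) := by positivity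
  unfold graphForm; linarith

lemma graphForm_smul (p a : E) (c : ℝ) : graphForm p (c • a) = c ^ 2 * graphForm p a := by
  simp only [graphForm, norm_smul, real_inner_smul_right, mul_pow, Real.norm_eq_abs, sq_abs]
  ring

lemma graphForm_self (p : E) : graphForm p p = ‖p‖ ^ 2 / (1 + ‖p‖ ^ 2) := by
  have : 1 + ‖p‖ ^ 2 ≠ 0 := by positivity
  rw [graphForm, real_inner_self_eq_norm_sq]
  field_simp
  ring

lemma graphForm_sub_smul (p a : E) (c : ℝ) :
    graphForm p (a - c • p) = graphForm p a - 2 * c * inner ℝ p a / (1 + ‖p‖ ^ 2)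
      + c ^ 2 * (‖p‖ ^ 2 / (1 + ‖p‖ ^ 2)) := by
  have : 1 + ‖p‖ ^ 2 ≠ 0 := by positivity
  rw [graphForm, graphForm, norm_sub_sq_real, norm_smul, mul_pow, Real.norm_eq_abs, sq_abs,
    inner_sub_right, real_inner_smul_right, real_inner_smul_right, real_inner_self_eq_norm_sq,
    real_inner_comm p a]
  field_simp
  ring

variable (b : OrthonormalBasis ι ℝ E)

lemma graphTrace_add (p : E) (q q' : E → ℝ) :
    graphTrace b p (fun w => q w + q' w) = graphTrace b p q + graphTrace b p q' := by
  simp only [graphTrace, Finset.sum_add_distrib]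
  ring

lemma graphTrace_const_mul (p : E) (c : ℝ) (q : E → ℝ) :
    graphTrace b p (fun w => c * q w) = c * graphTrace b p q := by
  simp only [graphTrace, ← Finset.mul_sum]
  ring

/-- With `S` the symmetric square root of `A`, the trace equals the sum of `B (S bᵢ) (S bᵢ)`.
Symmetry of `B` plays no role. -/
lemma graphTrace_nonpos (p : E) (B : E →ₗ[ℝ] E →ₗ[ℝ] ℝ) (hB : ∀ w, B w w ≤ 0) :
    graphTrace b p (fun w => B w w) ≤ 0 := by
  have hsum : ∑ i, inner ℝ (b i) p • b i = p := b.sum_repr' p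
  have h1 : ∑ i, inner ℝ p (b i) * B (b i) p = B p p := by
    have := congrArg (fun a => B a p) hsum
    simp only [map_sum, LinearMap.sum_apply, map_smul, LinearMap.smul_apply, smul_eq_mul] at this
    rw [← this]
    exact Finset.sum_congr rfl fun i _ => by rw [real_inner_comm]
  have h2 : ∑ i, inner ℝ p (b i) * B p (b i) = B p p := by
    have := congrArg (B p) hsum
    simp only [map_sum, map_smul, smul_eq_mul] at this
    rw [← this]
    exact Finset.sum_congr rfl fun i _ => by rw [real_inner_comm]
  have h3 : ∑ i, inner ℝ p (b i) ^ 2 = ‖p‖ ^ 2 := by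
    rw [← b.sum_sq_inner_right p]
    exact Finset.sum_congr rfl fun i _ => by rw [real_inner_comm]
  have key : ∑ i, B (rootMap p (b i)) (rootMap p (b i)) = graphTrace b p (fun w => B w w) := by
    have : ∀ i, B (rootMap p (b i)) (rootMap p (b i)) = B (b i) (b i)
        - rootCoeff p * (inner ℝ p (b i) * B (b i) p) - rootCoeff p * (inner ℝ p (b i) * B p (b i))
        + rootCoeff p ^ 2 * B p p * inner ℝ p (b i) ^ 2 := by
      intro i
      simp only [rootMap, map_sub, LinearMap.sub_apply, map_smul, LinearMap.smul_apply, smul_eq_mul]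
      ring
    simp only [this, Finset.sum_add_distrib, Finset.sum_sub_distrib, ← Finset.mul_sum, h1, h2, h3,
      graphTrace]
    rw [div_eq_mul_inv, ← rootCoeff_spec]
    ring
  rw [← key]
  exact Finset.sum_nonpos fun i _ => hB _

lemma graphTrace_inner_sq (p a : E) : graphTrace b p (fun w => inner ℝ a w ^ 2) = graphForm p a := by
  rw [graphTrace, graphForm, ← b.sum_sq_inner_right a]
  simp only [real_inner_comm]

lemma graphTrace_norm_sq (p : E) :
    graphTrace b p (fun w => ‖w‖ ^ 2) = Fintype.card ι - ‖p‖ ^ 2 / (1 + ‖p‖ ^ 2) := by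
  simp [graphTrace]

lemma graphTrace_norm_map_sq (p : E) (H : E →L[ℝ] E)
    (hH : ∀ a a', inner ℝ (H a) a' = inner ℝ a (H a')) :
    graphTrace b p (fun w => ‖H w‖ ^ 2) = ∑ i, ‖rootMap p (H (b i))‖ ^ 2 := by
  simp only [norm_rootMap_sq, graphForm, Finset.sum_sub_distrib, ← Finset.sum_div, graphTrace]
  congr 2
  rw [← b.sum_sq_inner_right (H p)]
  exact Finset.sum_congr rfl fun i _ => by rw [← hH, real_inner_comm]

lemma graphTrace_inner_map (p : E) (H : E →L[ℝ] E) (hH : ∀ a a', inner ℝ (H a) a' = inner ℝ a (H a')) :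
    graphTrace b p (fun w => inner ℝ (H w) w) =
      ∑ i, inner ℝ (rootMap p (H (b i))) (rootMap p (b i)) := by
  simp only [inner_rootMap_rootMap, Finset.sum_sub_distrib, ← Finset.sum_div, graphTrace]
  congr 2
  rw [real_inner_comm, ← hH, ← b.sum_inner_mul_inner]
  exact Finset.sum_congr rfl fun i _ => by rw [hH, real_inner_comm p]

lemma norm_rootMap_le (p a : E) : ‖rootMap p a‖ ≤ ‖a‖ :=
  le_of_sq_le_sq (by rw [norm_rootMap_sq]; exact graphForm_le p a) (norm_nonneg _)

/-- Cauchy–Schwarz on the sum of `⟨S H bᵢ, S bᵢ⟩`, with `|S bᵢ| ≤ 1`. This turns the equation into a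
lower bound for `tr (A H²)`. -/
lemma sq_graphTrace_inner_map_le (p : E) (H : E →L[ℝ] E)
    (hH : ∀ a a', inner ℝ (H a) a' = inner ℝ a (H a')) :
    graphTrace b p (fun w => inner ℝ (H w) w) ^ 2 ≤
      Fintype.card ι * graphTrace b p (fun w => ‖H w‖ ^ 2) := by
  rw [graphTrace_inner_map b p H hH, graphTrace_norm_map_sq b p H hH]
  refine sq_sum_le_card_mul_sum_sq.trans ?_
  rw [Finset.card_univ]
  gcongr ?_ * ∑ i, ?_ with i
  rw [← sq_abs]
  gcongr
  refine (abs_real_inner_le_norm _ _).trans (mul_le_of_le_one_right (norm_nonneg _) ?_)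
  simpa using norm_rootMap_le p (b i)

/-- Expanding `p` in the basis, `S H p` is a combination of the vectors `S H bᵢ`, and Cauchy–Schwarz
applies to the coefficients. -/
lemma graphForm_map_le (p : E) (H : E →L[ℝ] E)
    (hH : ∀ a a', inner ℝ (H a) a' = inner ℝ a (H a')) :
    graphForm p (H p) ≤ ‖p‖ ^ 2 * graphTrace b p (fun w => ‖H w‖ ^ 2) := by
  rw [graphTrace_norm_map_sq b p H hH, ← norm_rootMap_sq]
  have hlin : rootMap p (H p) = ∑ i, inner ℝ (b i) p • rootMap p (H (b i)) := by
    simp only [rootMap, smul_sub, smul_smul, Finset.sum_sub_distrib, ← Finset.sum_smul]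
    congr 1
    · conv_lhs => rw [← b.sum_repr' p]
      simp
    · congr 1
      conv_lhs => rw [← hH, ← b.sum_inner_mul_inner, Finset.mul_sum]
      exact Finset.sum_congr rfl fun i _ => by rw [hH]; ring
  have h1 : ‖rootMap p (H p)‖ ≤ ∑ i, |inner ℝ (b i) p| * ‖rootMap p (H (b i))‖ := by
    rw [hlin]
    refine (norm_sum_le _ _).trans_eq (Finset.sum_congr rfl fun i _ => ?_)
    rw [norm_smul, Real.norm_eq_abs]
  calc ‖rootMap p (H p)‖ ^ 2 ≤ (∑ i, |inner ℝ (b i) p| * ‖rootMap p (H (b i))‖) ^ 2 := by gcongr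
    _ ≤ (∑ i, |inner ℝ (b i) p| ^ 2) * ∑ i, ‖rootMap p (H (b i))‖ ^ 2 :=
      Finset.sum_mul_sq_le_sq_mul_sq _ _ _
    _ = _ := by simp only [sq_abs, b.sum_sq_inner_right]

/-- In dimension one `H` is a scalar, so `H p` determines `tr (A H²)`. This replaces the sign
argument of (c) when `n = 1`. -/
lemma norm_map_sq_of_unique [Unique ι] (p : E) (H : E →L[ℝ] E)
    (hH : ∀ a a', inner ℝ (H a) a' = inner ℝ a (H a')) :
    ‖H p‖ ^ 2 = ‖p‖ ^ 2 * (1 + ‖p‖ ^ 2) * graphTrace b p (fun w => ‖H w‖ ^ 2) := by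
  have hsum (a : E) : inner ℝ (b default) a • b default = a := by simpa using b.sum_repr' a
  have hsq (a : E) : inner ℝ (b default) a ^ 2 = ‖a‖ ^ 2 := by simpa using b.sum_sq_inner_right a
  set c := inner ℝ (b default) p
  have hHp : H p = c • H (b default) := by rw [← map_smul, hsum]
  have hin : inner ℝ p (H (b default)) ^ 2 = ‖p‖ ^ 2 * ‖H (b default)‖ ^ 2 := by
    rw [← hsum p, real_inner_smul_left, mul_pow, hsq, hsq, norm_smul]
    simp [hsq]
  have hpos : 1 + ‖p‖ ^ 2 ≠ 0 := by positivity
  rw [graphTrace_norm_map_sq b p H hH]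
  simp only [Finset.univ_unique, Finset.sum_singleton, norm_rootMap_sq, graphForm, hin]
  rw [hHp, norm_smul, mul_pow, Real.norm_eq_abs, sq_abs, hsq]
  field_simp
  ring

end GraphMetric

/-! ### Derivatives of the gradient and the differentiated equation. -/

noncomputable section Calculus

open Filter Topology

variable {n : ℕ} {u f : En n → ℝ} {R : ℝ} {x : En n}

lemma inner_gradient (u : En n → ℝ) (x a : En n) :
    inner ℝ (gradient u x) a = fderiv ℝ u x a :=
  InnerProductSpace.toDual_symm_apply

lemma continuousOn_gradient {s : Set (En n)} (hs : IsOpen s) (hu : ContDiffOn ℝ 1 u s) :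
    ContinuousOn (gradient u) s :=
  (InnerProductSpace.toDual ℝ (En n)).symm.continuous.comp_continuousOn
    (hu.continuousOn_fderiv_of_isOpen hs le_rfl)

lemma isOpen_noncriticalSet (hu : ContDiffOn ℝ 1 u (ballR n R)) :
    IsOpen (noncriticalSet u R) :=
  ((continuousOn_gradient Metric.isOpen_ball hu).norm).isOpen_inter_preimage Metric.isOpen_ball
    isOpen_Ioi

lemma ContDiffAt.gradient {k m : WithTop ℕ∞} (hu : ContDiffAt ℝ k u x) (hm : m + 1 ≤ k) :
    ContDiffAt ℝ m (gradient u) x :=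
  (InnerProductSpace.toDual ℝ (En n)).symm.toContinuousLinearEquiv.contDiff.contDiffAt.comp x
    (hu.fderiv_right hm)

lemma inner_fderiv_gradient_comm (hu : ContDiffAt ℝ 2 u x) (a c : En n) :
    inner ℝ (fderiv ℝ (gradient u) x a) c = inner ℝ a (fderiv ℝ (gradient u) x c) := by
  have hD : DifferentiableAt ℝ (fderiv ℝ u) x :=
    (hu.fderiv_right (m := 1) (by norm_num)).differentiableAt (by norm_num)
  have key : ∀ a c, inner ℝ (fderiv ℝ (gradient u) x a) c = fderiv ℝ (fderiv ℝ u) x a c := by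
    intro a c
    have h1 : HasFDerivAt (fun y => inner ℝ (gradient u y) c) _ x :=
      (((hu.gradient (m := 1) (by norm_num)).differentiableAt (by norm_num)).hasFDerivAt).inner ℝ
        (hasFDerivAt_const c x)
    have h2 : HasFDerivAt (fun y => fderiv ℝ u y c) _ x :=
      hD.hasFDerivAt.clm_apply (hasFDerivAt_const c x)
    simpa using congrArg (fun T => T a)
      (h1.unique (h2.congr_of_eventuallyEq (.of_forall fun y => inner_gradient u y c)))
  rw [key, (hu.isSymmSndFDerivAt (by simp)) a c, ← key, real_inner_comm]

lemma fderiv_fderiv_gradient_comm (hu : ContDiffAt ℝ 3 u x) (a c : En n) :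
    fderiv ℝ (fderiv ℝ (gradient u)) x a c = fderiv ℝ (fderiv ℝ (gradient u)) x c a :=
  ((hu.gradient (m := 2) (by norm_num)).isSymmSndFDerivAt (by simp)) a c

lemma hasFDerivAt_fderiv_gradient (hu : ContDiffAt ℝ 3 u x) :
    HasFDerivAt (fderiv ℝ (gradient u)) (fderiv ℝ (fderiv ℝ (gradient u)) x) x :=
  (((hu.gradient (m := 2) (by norm_num)).fderiv_right (m := 1) (by norm_num)).differentiableAt
    (by norm_num)).hasFDerivAt

lemma eventually_hasFDerivAt_gradient (hu : ContDiffAt ℝ 3 u x) :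
    ∀ᶠ y in 𝓝 x, HasFDerivAt (gradient u) (fderiv ℝ (gradient u) y) y := by
  filter_upwards [hu.eventually (by simp)] with y hy
  exact ((hy.gradient (m := 2) (by norm_num)).differentiableAt (by norm_num)).hasFDerivAt

lemma inner_fderiv_fderiv_gradient_comm (hu : ContDiffAt ℝ 3 u x) (a c d : En n) :
    inner ℝ (fderiv ℝ (fderiv ℝ (gradient u)) x a c) d =
      inner ℝ c (fderiv ℝ (fderiv ℝ (gradient u)) x a d) := by
  have h := hasFDerivAt_fderiv_gradient hu
  have h1 : HasFDerivAt (fun y => inner ℝ (fderiv ℝ (gradient u) y c) d) _ x :=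
    (h.clm_apply (hasFDerivAt_const c x)).inner ℝ (hasFDerivAt_const d x)
  have h2 : HasFDerivAt (fun y => inner ℝ c (fderiv ℝ (gradient u) y d)) _ x :=
    (hasFDerivAt_const c x).inner ℝ (h.clm_apply (hasFDerivAt_const d x))
  have heq : (fun y => inner ℝ (fderiv ℝ (gradient u) y c) d) =ᶠ[𝓝 x]
      fun y => inner ℝ c (fderiv ℝ (gradient u) y d) := by
    filter_upwards [hu.eventually (by simp)] with y hy
    exact inner_fderiv_gradient_comm (hy.of_le (by norm_num)) c d
  have := congrArg (fun T => T a) (h1.unique (h2.congr_of_eventuallyEq heq))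
  simpa using this

lemma hasDerivAt_line (x w : En n) (t : ℝ) : HasDerivAt (fun s : ℝ => x + s • w) w t := by
  simpa using ((hasDerivAt_id t).smul_const w).const_add x

lemma tendsto_line (x w : En n) : Tendsto (fun s : ℝ => x + s • w) (𝓝 0) (𝓝 x) := by
  simpa using (hasDerivAt_line x w 0).continuousAt.tendsto

lemma HasFDerivAt.hasDerivAt_line {F : Type*} [NormedAddCommGroup F] [NormedSpace ℝ F]
    {g : En n → F} {g' : En n →L[ℝ] F} {x w : En n} {t : ℝ} (h : HasFDerivAt g g' (x + t • w)) :
    HasDerivAt (fun s : ℝ => g (x + s • w)) (g' w) t :=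
  h.comp_hasDerivAt t (_root_.hasDerivAt_line x w t)

lemma HasFDerivAt.hasDerivAt_line_zero {F : Type*} [NormedAddCommGroup F] [NormedSpace ℝ F]
    {g : En n → F} {g' : En n →L[ℝ] F} {x w : En n} (h : HasFDerivAt g g' x) :
    HasDerivAt (fun s : ℝ => g (x + s • w)) (g' w) 0 := by
  apply HasFDerivAt.hasDerivAt_line
  simpa using h

lemma hasDerivAt_inv_sqrt_one_add {s : ℝ} (hs : 0 ≤ s) :
    HasDerivAt (fun s : ℝ => (√(1 + s))⁻¹) (-((√(1 + s))⁻¹ * (1 + s)⁻¹ / 2)) s := by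
  have h0 : 0 < √(1 + s) := Real.sqrt_pos.2 (by positivity)
  have h1 : √(1 + s) ^ 2 = 1 + s := Real.sq_sqrt (by positivity)
  refine (((hasDerivAt_id' s).const_add 1).sqrt (by positivity)).inv h0.ne' |>.congr_deriv ?_
  rw [← h1, Real.sqrt_sq h0.le]
  field_simp

lemma meanCurvatureOp_eq (h : DifferentiableAt ℝ (gradient u) x) :
    meanCurvatureOp u x = (√(1 + ‖gradient u x‖ ^ 2))⁻¹ *
      graphTrace (EuclideanSpace.basisFun (Fin n) ℝ) (gradient u x)
        (fun w => inner ℝ (fderiv ℝ (gradient u) x w) w) := by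
  set D := gradient u
  set H := fderiv ℝ D x
  have hc := (hasDerivAt_inv_sqrt_one_add (sq_nonneg ‖D x‖)).comp_hasFDerivAt x
    h.hasFDerivAt.norm_sq
  have hV := hc.smul h.hasFDerivAt
  have hV' : fderiv ℝ (fun y => (√(1 + ‖D y‖ ^ 2))⁻¹ • D y) x = _ := hV.fderiv
  have hsum : ∑ i, inner ℝ (D x) (H (EuclideanSpace.basisFun (Fin n) ℝ i)) * (D x) i
      = inner ℝ (D x) (H (D x)) := by
    have := congrArg (fun a => inner ℝ (D x) (H a))
      ((EuclideanSpace.basisFun (Fin n) ℝ).sum_repr' (D x))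
    simp only [map_sum, map_smul, inner_sum, real_inner_smul_right] at this
    rw [← this]
    refine Finset.sum_congr rfl fun i _ => ?_
    rw [mul_comm]
    simp [EuclideanSpace.inner_single_left]
  rw [meanCurvatureOp, divergence, hV', graphTrace, real_inner_comm (D x), ← hsum]
  rw [Finset.sum_div, ← Finset.sum_sub_distrib, Finset.mul_sum]
  refine Finset.sum_congr rfl fun i _ => ?_
  simp [EuclideanSpace.inner_single_right, H]
  ring

/-- The second identity is the first one differentiated along `p = ∇u(x)`, with the third
derivatives reordered by symmetry. The term in `graphForm p (H p)` comes from differentiating the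
coefficients of `A`. -/
lemma graphTrace_fderiv_fderiv_gradient (hu : ContDiffAt ℝ 3 u x)
    (heq : ∀ᶠ y in 𝓝 x, meanCurvatureOp u y = f (gradient u y))
    (hf : DifferentiableAt ℝ f (gradient u x)) :
    let p := gradient u x
    let H := fderiv ℝ (gradient u) x
    graphTrace (EuclideanSpace.basisFun (Fin n) ℝ) p (fun w => inner ℝ (H w) w) =
        √(1 + ‖p‖ ^ 2) * f p ∧
      graphTrace (EuclideanSpace.basisFun (Fin n) ℝ) p
          (fun w => inner ℝ p (fderiv ℝ (fderiv ℝ (gradient u)) x w w)) =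
        2 * graphForm p (H p) / (1 + ‖p‖ ^ 2) + √(1 + ‖p‖ ^ 2) * inner ℝ (gradient f p) (H p)
          + f p * inner ℝ p (H p) / √(1 + ‖p‖ ^ 2) := by
  intro p H
  set K := fderiv ℝ (fderiv ℝ (gradient u)) x with hK
  set b := EuclideanSpace.basisFun (Fin n) ℝ
  have hEq : ∀ᶠ y in 𝓝 x, graphTrace b (gradient u y)
      (fun w => inner ℝ (fderiv ℝ (gradient u) y w) w) = √(1 + ‖gradient u y‖ ^ 2) * f (gradient u y) := by
    filter_upwards [heq, eventually_hasFDerivAt_gradient hu] with y hy hy'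
    rw [meanCurvatureOp_eq hy'.differentiableAt, inv_mul_eq_iff_eq_mul₀] at hy
    · exact hy
    · have : 0 < √(1 + ‖gradient u y‖ ^ 2) := Real.sqrt_pos.2 (by positivity)
      positivity
  refine ⟨hEq.self_of_nhds, ?_⟩
  have hD : HasDerivAt (fun t : ℝ => gradient u (x + t • p)) (H p) 0 :=
    (eventually_hasFDerivAt_gradient hu).self_of_nhds.hasDerivAt_line_zero
  have hH : HasDerivAt (fun t : ℝ => fderiv ℝ (gradient u) (x + t • p)) (K p) 0 :=
    (hasFDerivAt_fderiv_gradient hu).hasDerivAt_line_zero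
  have hpp : gradient u (x + (0 : ℝ) • p) = p := by simp [p]
  have hHH : fderiv ℝ (gradient u) (x + (0 : ℝ) • p) = H := by simp [H]
  have hx : x + (0 : ℝ) • p = x := by simp
  have hpos : 0 < 1 + ‖p‖ ^ 2 := by positivity
  have hW : 0 < √(1 + ‖p‖ ^ 2) := Real.sqrt_pos.2 hpos
  have hv := (hD.norm_sq).const_add 1
  have hl : HasDerivAt (fun t : ℝ => graphTrace b (gradient u (x + t • p))
      (fun w => inner ℝ (fderiv ℝ (gradient u) (x + t • p) w) w)) _ 0 :=
    (HasDerivAt.fun_sum (u := Finset.univ) fun i _ =>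
      (hH.clm_apply (hasDerivAt_const 0 (b i))).inner ℝ (hasDerivAt_const 0 (b i))).fun_sub
      (((hH.clm_apply hD).inner ℝ hD).fun_div hv (by positivity))
  have hf' : HasDerivAt (fun t : ℝ => f (gradient u (x + t • p))) (fderiv ℝ f p (H p)) 0 :=
    HasFDerivAt.comp_hasDerivAt (l := f) (x := (0 : ℝ)) (by rw [hpp]; exact hf.hasFDerivAt) hD
  have hr := (hv.sqrt (by positivity)).fun_mul hf'
  have key := hl.unique (hr.congr_of_eventuallyEq ((tendsto_line x p).eventually hEq))
  have hsym := inner_fderiv_gradient_comm (hu.of_le (by norm_num : (2 : WithTop ℕ∞) ≤ 3))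
  have hK1 : ∀ w, inner ℝ p (K w w) = inner ℝ (K p w) w := by
    intro w
    rw [← inner_fderiv_fderiv_gradient_comm hu, fderiv_fderiv_gradient_comm hu]
  simp only [hx, inner_zero_right, map_zero, add_zero, zero_add] at key
  simp only [hK1, graphTrace, graphForm]
  rw [inner_gradient f]
  have e1 : inner ℝ (K p p + H (H p)) p = inner ℝ (K p p) p + ‖H p‖ ^ 2 := by
    rw [inner_add_left, hsym, real_inner_self_eq_norm_sq]
  have e2 : inner ℝ (H p) p = inner ℝ p (H p) := real_inner_comm _ _
  rw [show gradient u x = p from rfl, show fderiv ℝ (gradient u) x = H from rfl, e1, e2,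
    real_inner_self_eq_norm_sq, sub_eq_iff_eq_add] at key
  rw [key]
  field_simp
  ring

end Calculus

/-! ### The auxiliary function and the conditions at its maximum. -/

noncomputable section MaximumPrinciple

open Filter Topology

variable {n : ℕ} {u f : En n → ℝ} {R : ℝ} {x : En n}

/-- If `q > 0`, the second derivative test makes `a` a local minimum too, so `g` is locally constant
and `q = 0`. -/
lemma IsLocalMax.second_deriv_nonpos {g g' : ℝ → ℝ} {q a : ℝ} (hg : IsLocalMax g a)
    (h1 : ∀ᶠ t in 𝓝 a, HasDerivAt g (g' t) t) (h2 : HasDerivAt g' q a) : q ≤ 0 := by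
  by_contra! hq
  have hd : deriv g =ᶠ[𝓝 a] g' := h1.mono fun t ht => ht.deriv
  have h2' : HasDerivAt (deriv g) q a := h2.congr_of_eventuallyEq hd
  have hmin := isLocalMin_of_deriv_deriv_pos (f := g) (x₀ := a) (by rw [h2'.deriv]; exact hq)
    hg.deriv_eq_zero h1.self_of_nhds.continuousAt
  have hc : g =ᶠ[𝓝 a] fun _ => g a := by
    filter_upwards [hg, hmin] with t ht ht'
    exact le_antisymm ht ht'
  have h0 : deriv g =ᶠ[𝓝 a] fun _ => (0 : ℝ) := by
    simpa using hc.deriv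
  have := h2'.unique ((hasDerivAt_const a (0 : ℝ)).congr_of_eventuallyEq h0)
  exact hq.ne' this

lemma hasDerivAt_cutoff_line (x w : En n) (r t : ℝ) :
    HasDerivAt (fun t : ℝ => 1 - ‖x + t • w‖ ^ 2 / r ^ 2)
      (-(2 * inner ℝ (x + t • w) w / r ^ 2)) t :=
  (((hasDerivAt_line x w t).norm_sq).div_const _).const_sub 1

/-- The first and second order conditions at an interior maximum of
`F(|∇u|²) + k log (1 - |x|²/r²) + h(u)`. -/
lemma exists_bernstein_inequality (hu : ContDiffAt ℝ 3 u x)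
    (heq : ∀ᶠ y in 𝓝 x, meanCurvatureOp u y = f (gradient u y))
    (hf : DifferentiableAt ℝ f (gradient u x)) (hp : gradient u x ≠ 0)
    {F F₁ F₂ h h₁ h₂ : ℝ → ℝ} {k r : ℝ}
    (hF : ∀ s > 0, HasDerivAt F (F₁ s) s) (hF₁ : ∀ s > 0, HasDerivAt F₁ (F₂ s) s)
    (hh : ∀ᶠ y in 𝓝 x, HasDerivAt h (h₁ (u y)) (u y)) (hh₁ : HasDerivAt h₁ (h₂ (u x)) (u x))
    (hr : 0 < r) (hx : 0 < 1 - ‖x‖ ^ 2 / r ^ 2)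
    (hmax : IsLocalMax (fun y => F (‖gradient u y‖ ^ 2) + k * Real.log (1 - ‖y‖ ^ 2 / r ^ 2)
      + h (u y)) x) :
    ∃ (p y : En n) (τ : ℝ), p = gradient u x ∧
      (2 * F₁ (‖p‖ ^ 2)) • y - (2 * k / (r ^ 2 * (1 - ‖x‖ ^ 2 / r ^ 2))) • x + h₁ (u x) • p = 0 ∧
      F₁ (‖p‖ ^ 2) * (2 * τ + 4 * graphForm p y / (1 + ‖p‖ ^ 2)
          + 2 * √(1 + ‖p‖ ^ 2) * inner ℝ (gradient f p) y
          + 2 * f p * inner ℝ p y / √(1 + ‖p‖ ^ 2))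
        + 4 * F₂ (‖p‖ ^ 2) * graphForm p y
        - k * (2 * (n - ‖p‖ ^ 2 / (1 + ‖p‖ ^ 2)) / (r ^ 2 * (1 - ‖x‖ ^ 2 / r ^ 2))
          + 4 * graphForm p x / (r ^ 2 * (1 - ‖x‖ ^ 2 / r ^ 2)) ^ 2)
        + h₁ (u x) * (√(1 + ‖p‖ ^ 2) * f p) + h₂ (u x) * (‖p‖ ^ 2 / (1 + ‖p‖ ^ 2)) ≤ 0 ∧
      (√(1 + ‖p‖ ^ 2) * f p) ^ 2 ≤ n * τ ∧ graphForm p y ≤ ‖p‖ ^ 2 * τ ∧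
      (n = 1 → ‖y‖ ^ 2 = ‖p‖ ^ 2 * (1 + ‖p‖ ^ 2) * τ) := by
  obtain ⟨htr, hdiff⟩ := graphTrace_fderiv_fderiv_gradient hu heq hf
  set p := gradient u x with hpdef
  set H := fderiv ℝ (gradient u) x with hHdef
  set K := fderiv ℝ (fderiv ℝ (gradient u)) x with hKdef
  set b := EuclideanSpace.basisFun (Fin n) ℝ with hb
  set η := 1 - ‖x‖ ^ 2 / r ^ 2 with hη
  have hsym := inner_fderiv_gradient_comm (hu.of_le (by norm_num : (2 : WithTop ℕ∞) ≤ 3))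
  have hpos : 0 < ‖p‖ ^ 2 := by positivity
  have hg : ∀ w : En n, ∀ᶠ t in 𝓝 (0 : ℝ), HasDerivAt
      (fun t : ℝ => F (‖gradient u (x + t • w)‖ ^ 2) + k * Real.log (1 - ‖x + t • w‖ ^ 2 / r ^ 2)
        + h (u (x + t • w)))
      (F₁ (‖gradient u (x + t • w)‖ ^ 2) *
          (2 * inner ℝ (gradient u (x + t • w)) (fderiv ℝ (gradient u) (x + t • w) w))
        + k * (-(2 * inner ℝ (x + t • w) w / r ^ 2) / (1 - ‖x + t • w‖ ^ 2 / r ^ 2))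
        + h₁ (u (x + t • w)) * inner ℝ (gradient u (x + t • w)) w) t := by
    intro w
    have c1 : ∀ᶠ y in 𝓝 x, gradient u y ≠ 0 :=
      (hu.gradient (m := 2) (by norm_num)).continuousAt.eventually_ne hp
    have c2 : ∀ᶠ y in 𝓝 x, 0 < 1 - ‖y‖ ^ 2 / r ^ 2 :=
      ContinuousAt.eventually_lt (by fun_prop) (by fun_prop) hx
    filter_upwards [(tendsto_line x w).eventually c1, (tendsto_line x w).eventually c2,
      (tendsto_line x w).eventually (eventually_hasFDerivAt_gradient hu),
      (tendsto_line x w).eventually hh,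
      (tendsto_line x w).eventually (hu.eventually (by simp))] with t h1 h2 h3 h4 h5
    have hu' : HasDerivAt (fun t : ℝ => u (x + t • w)) (inner ℝ (gradient u (x + t • w)) w) t := by
      rw [inner_gradient]
      exact (h5.differentiableAt (by norm_num)).hasFDerivAt.hasDerivAt_line
    exact (((hF _ (by positivity)).comp t h3.hasDerivAt_line.norm_sq).add
      (((hasDerivAt_cutoff_line x w r t).log h2.ne').const_mul k)).add (h4.comp t hu')
  have hmaxline : ∀ w : En n, IsLocalMax
      (fun t : ℝ => F (‖gradient u (x + t • w)‖ ^ 2) + k * Real.log (1 - ‖x + t • w‖ ^ 2 / r ^ 2)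
        + h (u (x + t • w))) 0 := by
    intro w
    have := (tendsto_line x w).eventually hmax
    simpa [IsLocalMax, IsMaxFilter] using this
  have hfirst : ∀ w : En n, F₁ (‖p‖ ^ 2) * (2 * inner ℝ p (H w))
      + k * (-(2 * inner ℝ x w / r ^ 2) / η) + h₁ (u x) * inner ℝ p w = 0 := by
    intro w
    have := (hmaxline w).hasDerivAt_eq_zero (hg w).self_of_nhds
    simpa only [zero_smul, add_zero] using this
  have hsecond : ∀ w : En n, F₂ (‖p‖ ^ 2) * (2 * inner ℝ p (H w)) ^ 2
      + F₁ (‖p‖ ^ 2) * (2 * (‖H w‖ ^ 2 + inner ℝ p (K w w)))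
      - k * (2 * ‖w‖ ^ 2 / (r ^ 2 * η) + 4 * inner ℝ x w ^ 2 / (r ^ 2 * η) ^ 2)
      + h₂ (u x) * inner ℝ p w ^ 2 + h₁ (u x) * inner ℝ (H w) w ≤ 0 := by
    intro w
    have hD : HasDerivAt (fun t : ℝ => gradient u (x + t • w)) (H w) 0 :=
      (eventually_hasFDerivAt_gradient hu).self_of_nhds.hasDerivAt_line_zero
    have hH : HasDerivAt (fun t : ℝ => fderiv ℝ (gradient u) (x + t • w)) (K w) 0 :=
      (hasFDerivAt_fderiv_gradient hu).hasDerivAt_line_zero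
    have hu' : HasDerivAt (fun t : ℝ => u (x + t • w)) (inner ℝ p w) 0 := by
      rw [inner_gradient]
      exact (hu.differentiableAt (by norm_num)).hasFDerivAt.hasDerivAt_line_zero
    have hx0 : x + (0 : ℝ) • w = x := by simp
    have d1 := (HasDerivAt.comp (h₂ := F₁) (0 : ℝ) (by rw [hx0]; exact hF₁ _ hpos) hD.norm_sq).mul
      (((hD.inner ℝ (hH.clm_apply (hasDerivAt_const (0 : ℝ) w)))).const_mul 2)
    have d2 := (((((hasDerivAt_line x w 0).inner ℝ (hasDerivAt_const (0 : ℝ) w)).const_mul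
      2).div_const (r ^ 2)).neg.div (hasDerivAt_cutoff_line x w r 0)
        (by rw [hx0]; exact hx.ne')).const_mul k
    have d3 := (HasDerivAt.comp (h₂ := h₁) (0 : ℝ) (by rw [hx0]; exact hh₁) hu').mul
      (hD.inner ℝ (hasDerivAt_const (0 : ℝ) w))
    have := (hmaxline w).second_deriv_nonpos (hg w) ((d1.add d2).add d3)
    simp only [hx0, map_zero, add_zero, zero_add, inner_zero_right, Function.comp,
      Pi.neg_apply] at this
    rw [real_inner_self_eq_norm_sq, real_inner_self_eq_norm_sq] at this
    have hη' : -(2 * ‖w‖ ^ 2 / r ^ 2) * η - -(2 * inner ℝ x w / r ^ 2) * -(2 * inner ℝ x w / r ^ 2)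
        = - (2 * ‖w‖ ^ 2 / (r ^ 2 * η) + 4 * inner ℝ x w ^ 2 / (r ^ 2 * η) ^ 2) * η ^ 2 := by
      field_simp
      ring
    rw [← hη, hη', mul_div_cancel_right₀ _ (by positivity)] at this
    convert this using 1
    simp only [← hpdef, ← hHdef]
    ring
  have hy : ∀ w, inner ℝ p (H w) = inner ℝ (H p) w := fun w => (hsym p w).symm
  -- The Hessian of `u` is recorded only through `y = H p` and `τ = tr (A H²)`.
  refine ⟨p, H p, graphTrace b p (fun w => ‖H w‖ ^ 2), rfl, ?_, ?_, ?_, ?_, ?_⟩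
  · refine ext_inner_right ℝ fun w => ?_
    rw [inner_zero_left, ← hfirst w, hy, inner_add_left, inner_sub_left, real_inner_smul_left,
      real_inner_smul_left, real_inner_smul_left]
    field_simp
    ring
  -- The second derivatives along lines are polarised to a bilinear form, so that
  -- `graphTrace_nonpos` applies.
  · set B : En n →ₗ[ℝ] En n →ₗ[ℝ] ℝ := LinearMap.mk₂ ℝ
      (fun a c => F₂ (‖p‖ ^ 2) * (4 * (inner ℝ (H p) a * inner ℝ (H p) c))
        + F₁ (‖p‖ ^ 2) * (2 * (inner ℝ (H a) (H c) + inner ℝ p (K a c)))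
        - k * (2 * inner ℝ a c / (r ^ 2 * η) + 4 * (inner ℝ x a * inner ℝ x c) / (r ^ 2 * η) ^ 2)
        + h₂ (u x) * (inner ℝ p a * inner ℝ p c) + h₁ (u x) * inner ℝ (H a) c)
      (fun a a' c => by
        simp only [map_add, inner_add_left, inner_add_right, add_apply]; ring)
      (fun t a c => by
        simp only [map_smul, real_inner_smul_left, real_inner_smul_right, smul_eq_mul,
          smul_apply]; ring)
      (fun a c c' => by simp only [map_add, inner_add_right]; ring)
      (fun t a c => by simp only [map_smul, real_inner_smul_right, smul_eq_mul]; ring) with hB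
    have hBq : ∀ w, B w w = F₂ (‖p‖ ^ 2) * (4 * inner ℝ (H p) w ^ 2)
        + F₁ (‖p‖ ^ 2) * (2 * (‖H w‖ ^ 2 + inner ℝ p (K w w)))
        - k * (2 * ‖w‖ ^ 2 / (r ^ 2 * η) + 4 * inner ℝ x w ^ 2 / (r ^ 2 * η) ^ 2)
        + h₂ (u x) * inner ℝ p w ^ 2 + h₁ (u x) * inner ℝ (H w) w := by
      intro w
      simp only [hB, LinearMap.mk₂_apply, real_inner_self_eq_norm_sq]
      ring
    have hneg := graphTrace_nonpos b p B fun w => by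
      rw [hBq]
      refine le_of_eq_of_le ?_ (hsecond w)
      rw [hy]
      ring
    have t1 := graphTrace_inner_sq b p (H p)
    have t2 := graphTrace_norm_sq b p
    have t3 := graphTrace_inner_sq b p x
    have t4 := graphTrace_inner_sq b p p
    rw [graphForm_self] at t4
    rw [Fintype.card_fin] at t2
    have hexp : graphTrace b p (fun w => B w w) = F₂ (‖p‖ ^ 2) * 4 * graphTrace b p (fun w => inner ℝ (H p) w ^ 2)
        + F₁ (‖p‖ ^ 2) * 2 * graphTrace b p (fun w => ‖H w‖ ^ 2)
        + F₁ (‖p‖ ^ 2) * 2 * graphTrace b p (fun w => inner ℝ p (K w w))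
        - k * 2 / (r ^ 2 * η) * graphTrace b p (fun w => ‖w‖ ^ 2)
        - k * 4 / (r ^ 2 * η) ^ 2 * graphTrace b p (fun w => inner ℝ x w ^ 2)
        + h₂ (u x) * graphTrace b p (fun w => inner ℝ p w ^ 2)
        + h₁ (u x) * graphTrace b p (fun w => inner ℝ (H w) w) := by
      have : (fun w => B w w) = fun w => F₂ (‖p‖ ^ 2) * 4 * inner ℝ (H p) w ^ 2
          + F₁ (‖p‖ ^ 2) * 2 * ‖H w‖ ^ 2 + F₁ (‖p‖ ^ 2) * 2 * inner ℝ p (K w w)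
          + -(k * 2 / (r ^ 2 * η)) * ‖w‖ ^ 2 + -(k * 4 / (r ^ 2 * η) ^ 2) * inner ℝ x w ^ 2
          + h₂ (u x) * inner ℝ p w ^ 2 + h₁ (u x) * inner ℝ (H w) w := by
        funext w
        rw [hBq]
        ring
      rw [this]
      simp only [graphTrace_add, graphTrace_const_mul]
      ring
    rw [hexp, t1, t2, t3, t4, hdiff, htr] at hneg
    refine le_of_eq_of_le ?_ hneg
    ring
  · rw [← htr]
    simpa using sq_graphTrace_inner_map_le b p H hsym
  · exact graphForm_map_le b p H hsym
  · rintro rfl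
    exact norm_map_sq_of_unique b p H hsym

/-- Existence of an interior maximum of `(1 - |x|²/r²)ᵏ Z(|∇u|²) exp(h(u))`, `r = R/2`. -/
lemma exists_max_point (hR : 0 < R) (hu : IsSolution f u R) (h0 : gradient u 0 ≠ 0)
    {Z h : ℝ → ℝ} {k : ℝ} (hk : 0 < k) (hZ : ContinuousOn Z (Set.Ici 0)) (hZ0 : Z 0 = 0)
    (hZpos : ∀ s > 0, 0 < Z s) (hh : ∀ y ∈ ballR n R, ContinuousAt h (u y)) :
    ∃ x ∈ noncriticalSet u R, 0 < 1 - ‖x‖ ^ 2 / (R / 2) ^ 2 ∧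
      Z (‖gradient u 0‖ ^ 2) * Real.exp (h (u 0)) ≤
        (1 - ‖x‖ ^ 2 / (R / 2) ^ 2) ^ k * (Z (‖gradient u x‖ ^ 2) * Real.exp (h (u x))) ∧
      IsLocalMax (fun y => Real.log (Z (‖gradient u y‖ ^ 2))
        + k * Real.log (1 - ‖y‖ ^ 2 / (R / 2) ^ 2) + h (u y)) x := by
  -- Half the radius keeps the closed ball inside the domain, giving compactness without regularity
  -- at the boundary.
  set r := R / 2 with hr
  have hrpos : 0 < r := by positivity
  set Φ : En n → ℝ := fun y =>
    (1 - ‖y‖ ^ 2 / r ^ 2) ^ k * (Z (‖gradient u y‖ ^ 2) * Real.exp (h (u y))) with hΦ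
  have hsub : Metric.closedBall (0 : En n) r ⊆ ballR n R :=
    Metric.closedBall_subset_ball (by linarith)
  have hgc : ContinuousOn (gradient u) (Metric.closedBall 0 r) :=
    (continuousOn_gradient Metric.isOpen_ball hu.contDiffOn_one).mono hsub
  have huc : ContinuousOn (fun y => h (u y)) (Metric.closedBall 0 r) := by
    intro y hy
    exact (hh y (hsub hy)).comp_continuousWithinAt
      (hu.contDiffOn_one.continuousOn.mono hsub y hy)
  have hcont : ContinuousOn Φ (Metric.closedBall 0 r) := by
    refine ContinuousOn.mul (ContinuousOn.rpow_const (by fun_prop) fun _ _ => Or.inr hk.le)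
      (ContinuousOn.mul (hZ.comp (hgc.norm.pow 2) fun y _ => ?_) huc.rexp)
    exact Set.mem_Ici.2 (sq_nonneg ‖gradient u y‖)
  obtain ⟨x, hxB, hxmax⟩ := (isCompact_closedBall (0 : En n) r).exists_isMaxOn
    ⟨0, Metric.mem_closedBall_self hrpos.le⟩ hcont
  have hΦ0 : Φ 0 = Z (‖gradient u 0‖ ^ 2) * Real.exp (h (u 0)) := by simp [hΦ]
  have hΦ0pos : 0 < Φ 0 := by
    rw [hΦ0]
    exact mul_pos (hZpos _ (by positivity)) (Real.exp_pos _)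
  have hΦx : Φ 0 ≤ Φ x := hxmax (Metric.mem_closedBall_self hrpos.le)
  have hηnn : 0 ≤ 1 - ‖x‖ ^ 2 / r ^ 2 := by
    rw [mem_closedBall_zero_iff] at hxB
    rw [sub_nonneg, div_le_one (by positivity)]
    gcongr
  have hηpos : 0 < 1 - ‖x‖ ^ 2 / r ^ 2 := by
    refine hηnn.lt_of_ne fun he => ?_
    have : Φ x = 0 := by simp only [hΦ, ← he, Real.zero_rpow hk.ne', zero_mul]
    linarith
  have hpx : gradient u x ≠ 0 := by
    intro he
    have : Φ x = 0 := by simp [hΦ, he, hZ0]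
    linarith
  have hxU : x ∈ noncriticalSet u R := ⟨hsub hxB, norm_pos_iff.2 hpx⟩
  refine ⟨x, hxU, hηpos, hΦ0 ▸ hΦx, ?_⟩
  have hlog : ∀ y, 0 < 1 - ‖y‖ ^ 2 / r ^ 2 → gradient u y ≠ 0 →
      Real.log (Φ y) = Real.log (Z (‖gradient u y‖ ^ 2))
        + k * Real.log (1 - ‖y‖ ^ 2 / r ^ 2) + h (u y) := by
    intro y hy hy'
    have hz := hZpos (‖gradient u y‖ ^ 2) (by positivity)
    rw [Real.log_mul (by positivity) (by positivity), Real.log_mul hz.ne' (Real.exp_ne_zero _),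
      Real.log_exp, Real.log_rpow hy]
    ring
  have c2 : ∀ᶠ y in 𝓝 x, 0 < 1 - ‖y‖ ^ 2 / r ^ 2 :=
    ContinuousAt.eventually_lt (by fun_prop) (by fun_prop) hηpos
  filter_upwards [(isOpen_noncriticalSet hu.contDiffOn_one).mem_nhds hxU, c2] with y hy hy'
  have hyp : gradient u y ≠ 0 := norm_pos_iff.1 hy.2
  rw [← hlog y hy' hyp, ← hlog x hηpos hpx]
  have hz := hZpos (‖gradient u y‖ ^ 2) (by positivity)
  refine Real.log_le_log (by positivity) (hxmax ?_)
  rw [mem_closedBall_zero_iff]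
  rw [sub_pos, div_lt_one (by positivity)] at hy'
  exact (lt_of_pow_lt_pow_left₀ 2 hrpos.le hy').le

end MaximumPrinciple

/-! ### The inequality at the maximum for `Z s = log (1 + s)` and `Z s = s`. -/

noncomputable section BernsteinPoints

open Filter Topology

variable {n : ℕ} {u f : En n → ℝ} {R : ℝ}

lemma C1AwayFromZero.differentiableAt (hf : C1AwayFromZero f) {p : En n} (hp : p ≠ 0) :
    DifferentiableAt ℝ f p :=
  (ContDiffOn.contDiffAt hf (isOpen_ne.mem_nhds hp)).differentiableAt (by norm_num)

lemma IsSolution.contDiffAt_three (hu : IsSolution f u R) {x : En n} (hx : x ∈ noncriticalSet u R) :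
    ContDiffAt ℝ 3 u x :=
  hu.contDiffOn_three.contDiffAt ((isOpen_noncriticalSet hu.contDiffOn_one).mem_nhds hx)

lemma IsSolution.eventually_equation (hu : IsSolution f u R) {x : En n}
    (hx : x ∈ noncriticalSet u R) : ∀ᶠ y in 𝓝 x, meanCurvatureOp u y = f (gradient u y) :=
  ((isOpen_noncriticalSet hu.contDiffOn_one).eventually_mem hx).mono hu.equation

lemma IsSolution.eventually_of_ball (hu : IsSolution f u R) {x : En n}
    (hx : x ∈ noncriticalSet u R) {P : ℝ → Prop} (hP : ∀ y ∈ ballR n R, P (u y)) :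
    ∀ᶠ y in 𝓝 x, P (u y) :=
  ((isOpen_noncriticalSet hu.contDiffOn_one).eventually_mem hx).mono fun y hy => hP y hy.1

lemma hasDerivAt_log_one_add {s : ℝ} (hs : 0 ≤ s) :
    HasDerivAt (fun s : ℝ => Real.log (1 + s)) (1 + s)⁻¹ s := by
  simpa using ((hasDerivAt_id' s).const_add 1).log (by positivity)

lemma log_one_add_pos {s : ℝ} (hs : 0 < s) : 0 < Real.log (1 + s) := Real.log_pos (by linarith)

lemma hasDerivAt_log_log_one_add {s : ℝ} (hs : 0 < s) :
    HasDerivAt (fun s : ℝ => Real.log (Real.log (1 + s))) ((1 + s) * Real.log (1 + s))⁻¹ s := by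
  refine ((hasDerivAt_log_one_add hs.le).log (log_one_add_pos hs).ne').congr_deriv ?_
  rw [mul_inv, div_eq_mul_inv]

lemma hasDerivAt_inv_mul_log_one_add {s : ℝ} (hs : 0 < s) :
    HasDerivAt (fun s : ℝ => ((1 + s) * Real.log (1 + s))⁻¹)
      (-(Real.log (1 + s) + 1) / ((1 + s) * Real.log (1 + s)) ^ 2) s := by
  have h1 := log_one_add_pos hs
  refine ((((hasDerivAt_id' s).const_add 1).fun_mul (hasDerivAt_log_one_add hs.le)).fun_inv
    (by positivity)).congr_deriv ?_
  field_simp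

/-- Bound of the zeroth order term produced by the cutoff function. -/
lemma cutoff_term_le {p x : En n} {r k : ℝ} (hr : 0 < r) (hk : 0 < k)
    (hη : 0 < 1 - ‖x‖ ^ 2 / r ^ 2) :
    k * (2 * (n - ‖p‖ ^ 2 / (1 + ‖p‖ ^ 2)) / (r ^ 2 * (1 - ‖x‖ ^ 2 / r ^ 2))
      + 4 * graphForm p x / (r ^ 2 * (1 - ‖x‖ ^ 2 / r ^ 2)) ^ 2)
      ≤ k * (2 * n + 4) * (r * (1 - ‖x‖ ^ 2 / r ^ 2))⁻¹ ^ 2 ∧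
    ‖(2 * k / (r ^ 2 * (1 - ‖x‖ ^ 2 / r ^ 2))) • x‖ ≤ 2 * k * (r * (1 - ‖x‖ ^ 2 / r ^ 2))⁻¹ := by
  have hx : ‖x‖ ^ 2 < r ^ 2 := by
    rwa [sub_pos, div_lt_one (by positivity)] at hη
  have hη1 : 1 - ‖x‖ ^ 2 / r ^ 2 ≤ 1 := by
    have : 0 ≤ ‖x‖ ^ 2 / r ^ 2 := by positivity
    linarith
  have hT := (graphForm_le p x).trans hx.le
  have hv : 0 ≤ ‖p‖ ^ 2 / (1 + ‖p‖ ^ 2) := by positivity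
  have hxr : ‖x‖ ≤ r := (lt_of_pow_lt_pow_left₀ 2 hr.le hx).le
  generalize 1 - ‖x‖ ^ 2 / r ^ 2 = η at *
  constructor
  · rw [mul_assoc]
    gcongr
    have e : (2 * n + 4 : ℝ) * (r * η)⁻¹ ^ 2 =
        2 * n / (r * η) ^ 2 + 4 * r ^ 2 / (r ^ 2 * η) ^ 2 := by
      field_simp
    rw [e]
    gcongr ?_ / ?_ + ?_
    · linarith
    · rw [mul_pow]
      gcongr
      nlinarith
    · gcongr
  · rw [norm_smul, Real.norm_eq_abs, abs_of_pos (by positivity)]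
    calc 2 * k / (r ^ 2 * η) * ‖x‖ ≤ 2 * k / (r ^ 2 * η) * r := by gcongr
      _ = _ := by field_simp

/-- Here `F = log (log (1 + s))` and `ζ = 2 F'(|p|²) H p`, which the first order condition splits
into the cutoff part `a` and a multiple of `p`. The contribution of `F''` and that of the
differentiated coefficients combine exactly to `-graphForm p ζ`. The number `τ` is `tr (A H²)`
divided by `1 + |p|²`. -/
lemma IsSolution.exists_point_log_log (hR : 0 < R) (hu : IsSolution f u R)
    (hf : ∀ p ≠ 0, DifferentiableAt ℝ f p) (h0 : gradient u 0 ≠ 0)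
    {h h₁ h₂ : ℝ → ℝ} {k : ℝ} (hk : 0 < k) (hh : ∀ y ∈ ballR n R, HasDerivAt h (h₁ (u y)) (u y))
    (hh₁ : ∀ y ∈ ballR n R, HasDerivAt h₁ (h₂ (u y)) (u y)) :
    ∃ (x p a ζ : En n) (η τ : ℝ), x ∈ ballR n R ∧ p ≠ 0 ∧ 0 < η ∧ η ≤ 1 ∧
      Real.log (1 + ‖gradient u 0‖ ^ 2) * Real.exp (h (u 0)) ≤
        η ^ k * (Real.log (1 + ‖p‖ ^ 2) * Real.exp (h (u x))) ∧
      ζ = a - h₁ (u x) • p ∧ ‖a‖ ≤ 2 * k * (R / 2 * η)⁻¹ ∧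
      2 * τ / Real.log (1 + ‖p‖ ^ 2) + √(1 + ‖p‖ ^ 2) * inner ℝ (gradient f p) ζ
        + f p * inner ℝ p ζ / √(1 + ‖p‖ ^ 2) - graphForm p ζ + h₁ (u x) * (√(1 + ‖p‖ ^ 2) * f p)
        + h₂ (u x) * (‖p‖ ^ 2 / (1 + ‖p‖ ^ 2)) ≤ k * (2 * n + 4) * (R / 2 * η)⁻¹ ^ 2 ∧
      f p ^ 2 ≤ n * τ ∧ graphForm p ζ * Real.log (1 + ‖p‖ ^ 2) ^ 2 ≤ 4 * τ ∧
      (n = 1 → 4 * ‖p‖ ^ 2 * τ ≤ ‖ζ‖ ^ 2 * Real.log (1 + ‖p‖ ^ 2) ^ 2) := by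
  obtain ⟨x, hxU, hη, hle, hmax⟩ := exists_max_point hR hu h0 (Z := fun s => Real.log (1 + s)) hk
    (fun s hs => (hasDerivAt_log_one_add hs).continuousAt.continuousWithinAt) (by simp)
    (fun s hs => log_one_add_pos hs) (fun y hy => (hh y hy).continuousAt)
  have hp : gradient u x ≠ 0 := norm_pos_iff.1 hxU.2
  obtain ⟨p, y, τ, rfl, h1, h2, h3, h4, h5⟩ := exists_bernstein_inequality (hu.contDiffAt_three hxU)
    (hu.eventually_equation hxU) (hf _ hp) hp (F := fun s => Real.log (Real.log (1 + s)))
    (fun s hs => hasDerivAt_log_log_one_add hs) (fun s hs => hasDerivAt_inv_mul_log_one_add hs)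
    (hu.eventually_of_ball hxU (P := fun s => HasDerivAt h (h₁ s) s) hh) (hh₁ x hxU.1) (half_pos hR) hη hmax
  set p := gradient u x
  obtain ⟨c1, c2⟩ := cutoff_term_le (p := p) (half_pos hR) hk hη
  have hη1 : 1 - ‖x‖ ^ 2 / (R / 2) ^ 2 ≤ 1 := by
    have : 0 ≤ ‖x‖ ^ 2 / (R / 2) ^ 2 := by positivity
    linarith
  have hv : 0 < ‖p‖ ^ 2 := by positivity
  have hz := log_one_add_pos hv
  have hW2 : √(1 + ‖p‖ ^ 2) ^ 2 = 1 + ‖p‖ ^ 2 := Real.sq_sqrt (by positivity)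
  set α := ((1 + ‖p‖ ^ 2) * Real.log (1 + ‖p‖ ^ 2))⁻¹ with hα
  have hαpos : 0 < α := by positivity
  refine ⟨x, p, (2 * k / ((R / 2) ^ 2 * (1 - ‖x‖ ^ 2 / (R / 2) ^ 2))) • x, (2 * α) • y,
    1 - ‖x‖ ^ 2 / (R / 2) ^ 2, τ / (1 + ‖p‖ ^ 2), hxU.1, hp, hη, hη1, hle, ?_, c2, ?_, ?_, ?_, ?_⟩
  · rw [eq_sub_iff_add_eq, ← sub_eq_zero, ← h1]
    abel
  · refine le_trans ?_ c1
    rw [← sub_nonpos]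
    refine le_of_eq_of_le ?_ h2
    rw [real_inner_smul_right, real_inner_smul_right, graphForm_smul, hα]
    field_simp
    ring
  · rw [mul_pow, hW2] at h3
    rw [← mul_div_assoc, le_div_iff₀ (by positivity)]
    linarith
  · rw [graphForm_smul, hα]
    calc _ = 4 * (graphForm p y / (1 + ‖p‖ ^ 2) / (1 + ‖p‖ ^ 2)) := by field_simp; ring
      _ ≤ 4 * (τ / (1 + ‖p‖ ^ 2)) := by
        have hτ : graphForm p y ≤ τ * (1 + ‖p‖ ^ 2) := by
          have : 0 ≤ ‖p‖ ^ 2 * τ := (graphForm_nonneg p y).trans h4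
          have := nonneg_of_mul_nonneg_right this hv
          nlinarith
        gcongr
        rwa [div_le_iff₀ (by positivity)]
  · intro hn
    rw [norm_smul, mul_pow, h5 hn, Real.norm_eq_abs, sq_abs, hα]
    apply le_of_eq
    field_simp
    ring

/-- Here `F = log` and `h = 0`, so `2 F'(|p|²) H p` is just the cutoff vector `a`; the nonnegative
term from the differentiated coefficients is dropped. -/
lemma IsSolution.exists_point_log (hR : 0 < R) (hu : IsSolution f u R)
    (hf : ∀ p ≠ 0, DifferentiableAt ℝ f p) (h0 : gradient u 0 ≠ 0) {k : ℝ} (hk : 0 < k) :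
    ∃ (p a : En n) (η τ : ℝ), p ≠ 0 ∧ 0 < η ∧ η ≤ 1 ∧
      ‖gradient u 0‖ ^ 2 ≤ η ^ k * ‖p‖ ^ 2 ∧ ‖a‖ ≤ 2 * k * (R / 2 * η)⁻¹ ∧
      2 * τ / ‖p‖ ^ 2 + √(1 + ‖p‖ ^ 2) * inner ℝ (gradient f p) a
        + f p * inner ℝ p a / √(1 + ‖p‖ ^ 2) - graphForm p a
        ≤ k * (2 * n + 4) * (R / 2 * η)⁻¹ ^ 2 ∧
      (1 + ‖p‖ ^ 2) * f p ^ 2 ≤ n * τ := by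
  obtain ⟨x, hxU, hη, hle, hmax⟩ := exists_max_point hR hu h0 (Z := fun s => s) (h := fun _ => 0) hk
    continuousOn_id rfl (fun s hs => hs) (fun y hy => continuousAt_const)
  have hp : gradient u x ≠ 0 := norm_pos_iff.1 hxU.2
  obtain ⟨p, y, τ, rfl, h1, h2, h3, -⟩ := exists_bernstein_inequality (hu.contDiffAt_three hxU)
    (hu.eventually_equation hxU) (hf _ hp) hp (F := Real.log) (h₁ := fun _ => 0) (h₂ := fun _ => 0)
    (fun s hs => Real.hasDerivAt_log hs.ne') (fun s hs => hasDerivAt_inv hs.ne')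
    (.of_forall fun _ => hasDerivAt_const _ _) (hasDerivAt_const _ _) (half_pos hR) hη hmax
  set p := gradient u x
  obtain ⟨c1, c2⟩ := cutoff_term_le (p := p) (half_pos hR) hk hη
  have hη1 : 1 - ‖x‖ ^ 2 / (R / 2) ^ 2 ≤ 1 := by
    have : 0 ≤ ‖x‖ ^ 2 / (R / 2) ^ 2 := by positivity
    linarith
  have hv : 0 < ‖p‖ ^ 2 := by positivity
  have hW2 : √(1 + ‖p‖ ^ 2) ^ 2 = 1 + ‖p‖ ^ 2 := Real.sq_sqrt (by positivity)
  rw [zero_smul, add_zero, sub_eq_zero] at h1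
  rw [← h1] at c2
  refine ⟨p, (2 * (‖p‖ ^ 2)⁻¹) • y, _, τ, hp, hη, hη1, by simpa using hle, c2, ?_, ?_⟩
  · refine le_trans ?_ c1
    rw [← sub_nonpos]
    refine le_trans ?_ h2
    rw [real_inner_smul_right, real_inner_smul_right, graphForm_smul]
    have hT : 0 ≤ (‖p‖ ^ 2)⁻¹ * (4 * graphForm p y / (1 + ‖p‖ ^ 2)) := by
      have := graphForm_nonneg p y
      positivity
    rw [← sub_nonneg]
    refine le_of_le_of_eq hT ?_
    field_simp
    ring
  · rwa [mul_pow, hW2] at h3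

end BernsteinPoints

/-! ### Cases (a) and (b): no dependence on the oscillation. -/

noncomputable section PowerAndLogGrowth

variable {n : ℕ} {u f : En n → ℝ} {R : ℝ}

lemma le_mul_of_quadratic_le {c B D δ X : ℝ} (hc : 0 < c) (hB : 0 ≤ B) (hD : 0 ≤ D) (hδ : 0 ≤ δ)
    (h : c * X ^ 2 ≤ B * δ * X + D * δ ^ 2) : X ≤ ((B + D) / c + 1) * δ := by
  by_contra! hlt
  have hM : 0 ≤ (B + D) / c := by positivity
  have hδX : δ < X := lt_of_le_of_lt (by nlinarith) hlt
  have hX0 : 0 < X := hδ.trans_lt hδX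
  have h1 : c * X ^ 2 ≤ (B + D) * δ * X := by
    have : D * δ ^ 2 ≤ D * δ * X := by rw [pow_two, ← mul_assoc]; gcongr
    linarith
  have h2 : c * X ≤ (B + D) * δ := le_of_mul_le_mul_right (by linarith) hX0
  have h3 : X ≤ (B + D) / c * δ := by
    rw [div_mul_eq_mul_div, le_div_iff₀ hc]; linarith
  nlinarith

lemma le_div_rpow_of_rpow_le {a A s : ℝ} (hs : 0 < s) (ha : 0 ≤ a) (hA : 0 ≤ A) (hR : 0 < R)
    (h : a ^ s ≤ A / R) : a ≤ A ^ (1 / s) / R ^ (1 / s) := by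
  rw [← Real.div_rpow hA hR.le, one_div]
  calc a = (a ^ s) ^ s⁻¹ := (Real.rpow_rpow_inv ha hs.ne').symm
    _ ≤ _ := Real.rpow_le_rpow (by positivity) h (by positivity)

/-- The condition `1 ≤ k * s` lets the weight `η ^ k`, raised to the power `s`, cancel the factor
`η⁻¹` in the bound at the maximum point. -/
lemma le_of_cutoff_rpow_le {a₀ a η k s A : ℝ} (ha₀ : 0 ≤ a₀) (ha : 0 ≤ a) (hη : 0 < η) (hη1 : η ≤ 1)
    (hs : 0 < s) (hks : 1 ≤ k * s) (hA : 0 ≤ A) (hR : 0 < R) (h : a₀ ≤ η ^ k * a)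
    (h' : a ^ s ≤ A * (R / 2 * η)⁻¹) : a₀ ≤ (2 * A) ^ (1 / s) / R ^ (1 / s) := by
  refine le_div_rpow_of_rpow_le hs ha₀ (by positivity) hR ?_
  calc a₀ ^ s ≤ (η ^ k * a) ^ s := by gcongr
    _ = η ^ (k * s) * a ^ s := by
      rw [Real.mul_rpow (by positivity) ha, Real.rpow_mul hη.le]
    _ ≤ η ^ (1 : ℝ) * (A * (R / 2 * η)⁻¹) := by
      gcongr ?_ * ?_
      exact Real.rpow_le_rpow_of_exponent_ge hη hη1 hks
    _ = 2 * A / R := by rw [Real.rpow_one]; field_simp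

lemma natCast_pos_of_ne_zero {p : En n} (hp : p ≠ 0) : (0 : ℝ) < n := by
  rcases Nat.eq_zero_or_pos n with rfl | h
  · exact absurd (Subsingleton.elim p 0) hp
  · exact_mod_cast h

lemma abs_inner_div_sqrt_le (p a : En n) :
    |inner ℝ p a / √(1 + ‖p‖ ^ 2)| ≤ ‖a‖ := by
  have hW : 0 < √(1 + ‖p‖ ^ 2) := Real.sqrt_pos.2 (by positivity)
  rw [abs_div, abs_of_pos hW, div_le_iff₀ hW, mul_comm]
  refine (abs_real_inner_le_norm p a).trans ?_
  gcongr
  exact Real.le_sqrt_of_sq_le (by linarith)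

/-- Interior gradient bound for right-hand sides of power type. -/
theorem gradient_bound_of_condA1 (n : ℕ) (θ m₁ m₂ : ℝ) (hθ : 0 < θ) (hm₁ : 0 < m₁) (hm₂ : 0 < m₂) :
    ∃ C : ℝ, 0 < C ∧
      ∀ (R : ℝ) (f u : En n → ℝ), 0 < R → C1AwayFromZero f → CondA1 θ m₁ m₂ f →
        IsSolution f u R → ‖gradient u 0‖ ≤ C / R ^ (1 / θ) := by
  -- The maximised quantity is quadratic in the gradient, so this gives `|∇u(0)| ≤ η ^ (1 / θ) *
  -- |p|`, as the cancellation of `η` requires.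
  set k := 2 / θ with hk
  have hkpos : 0 < k := by positivity
  set B := 2 * k * (1 / √m₁ + 1) with hB
  set D := 4 * k ^ 2 + k * (2 * n + 4) with hD
  set M := (B + D) / (2 / n) + 1 with hM
  have hMpos : 0 < M := by positivity
  refine ⟨(2 * (M / √m₂)) ^ (1 / θ), by positivity, fun R f u hR hf hA hu => ?_⟩
  by_cases h0 : gradient u 0 = 0
  · rw [h0, norm_zero]; positivity
  obtain ⟨p, a, η, τ, hp, hη, hη1, hle, ha, hineq, hτ⟩ :=
    hu.exists_point_log hR (fun p hp => hf.differentiableAt hp) h0 hkpos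
  have hn := natCast_pos_of_ne_zero hp
  have hv : 0 < ‖p‖ := norm_pos_iff.2 hp
  have hcond := hA p hp
  set δ := (R / 2 * η)⁻¹ with hδ
  have hδpos : 0 < δ := by positivity
  have hW : 0 < √(1 + ‖p‖ ^ 2) := Real.sqrt_pos.2 (by positivity)
  have hW2 : √(1 + ‖p‖ ^ 2) ^ 2 = 1 + ‖p‖ ^ 2 := Real.sq_sqrt (by positivity)
  set W := √(1 + ‖p‖ ^ 2)
  -- The `τ` term is at least `(2 / n) * X ^ 2`, and the structural condition bounds `W * |∇f|` by
  -- `X / √m₁`.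
  set X := W * |f p| / ‖p‖ with hX
  have hX0 : 0 ≤ X := by positivity
  have hfX : |f p| ≤ X := by
    have : ‖p‖ ≤ W := Real.le_sqrt_of_sq_le (by linarith)
    rw [hX, le_div_iff₀ hv, mul_comm]
    gcongr
  have hgrad : W * ‖gradient f p‖ ≤ X / √m₁ := by
    have h1 : √m₁ * ‖p‖ * ‖gradient f p‖ ≤ |f p| := by
      refine abs_le_of_sq_le_sq' ?_ (abs_nonneg _) |>.2
      have : 0 ≤ m₂ * ‖p‖ ^ (2 * θ) := by positivity
      rw [sq_abs, mul_pow, mul_pow, Real.sq_sqrt hm₁.le]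
      linarith
    rw [hX, le_div_iff₀ (by positivity), le_div_iff₀ hv]
    calc W * ‖gradient f p‖ * √m₁ * ‖p‖ = W * (√m₁ * ‖p‖ * ‖gradient f p‖) := by ring
      _ ≤ _ := by gcongr
  have hquad : 2 / n * X ^ 2 ≤ B * δ * X + D * δ ^ 2 := by
    have e1 : 2 / n * X ^ 2 ≤ 2 * τ / ‖p‖ ^ 2 := by
      rw [hX, div_pow, mul_pow, hW2, sq_abs, ← mul_div_assoc]
      gcongr ?_ / _
      rw [div_mul_eq_mul_div, div_le_iff₀ hn]
      linarith
    have e2 : -(2 * k * δ * (X / √m₁)) ≤ W * inner ℝ (gradient f p) a := by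
      refine (neg_le_neg ?_).trans (neg_abs_le _)
      rw [abs_mul, abs_of_pos hW]
      calc W * |inner ℝ (gradient f p) a| ≤ W * (‖gradient f p‖ * ‖a‖) := by
            gcongr; exact abs_real_inner_le_norm _ _
        _ = ‖a‖ * (W * ‖gradient f p‖) := by ring
        _ ≤ _ := by gcongr
    have e3 : -(2 * k * δ * X) ≤ f p * inner ℝ p a / W := by
      refine (neg_le_neg ?_).trans (neg_abs_le _)
      rw [mul_div_assoc, abs_mul, mul_comm]
      gcongr
      exact (abs_inner_div_sqrt_le p a).trans ha
    have e4 : graphForm p a ≤ 4 * k ^ 2 * δ ^ 2 := by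
      refine (graphForm_le p a).trans ?_
      calc ‖a‖ ^ 2 ≤ (2 * k * δ) ^ 2 := by gcongr
        _ = _ := by ring
    have e5 : B * δ * X = 2 * k * δ * (X / √m₁) + 2 * k * δ * X := by rw [hB]; ring
    have e6 : D * δ ^ 2 = 4 * k ^ 2 * δ ^ 2 + k * (2 * n + 4) * δ ^ 2 := by rw [hD]; ring
    linarith
  have hXM : X ≤ M * δ :=
    le_mul_of_quadratic_le (by positivity) (by positivity) (by positivity) hδpos.le hquad
  have hpθ : ‖p‖ ^ θ ≤ M / √m₂ * δ := by
    rw [div_mul_eq_mul_div, le_div_iff₀ (by positivity)]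
    refine le_trans ?_ (hfX.trans hXM)
    refine abs_le_of_sq_le_sq' ?_ (abs_nonneg _) |>.2
    have : 0 ≤ m₁ * ‖p‖ ^ 2 * ‖gradient f p‖ ^ 2 := by positivity
    rw [sq_abs, mul_pow, Real.sq_sqrt hm₂.le, ← Real.rpow_natCast (‖p‖ ^ θ), ← Real.rpow_mul hv.le]
    rw [show θ * ((2 : ℕ) : ℝ) = 2 * θ by push_cast; ring]
    linarith
  refine le_of_cutoff_rpow_le (k := 1 / θ) (norm_nonneg _) hv.le hη hη1 hθ
    (by field_simp; rfl) (by positivity) hR ?_ hpθ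
  refine abs_le_of_sq_le_sq' ?_ (by positivity) |>.2
  rw [mul_pow, ← Real.rpow_natCast (η ^ (1 / θ)), ← Real.rpow_mul hη.le]
  rwa [show 1 / θ * ((2 : ℕ) : ℝ) = k by rw [hk]; push_cast; ring]

/-- Interior gradient bound for right-hand sides of superlinear logarithmic type. -/
theorem gradient_bound_of_condA2 (n : ℕ) (θ m₁ m₂ m₃ : ℝ) (hθ : 1 < θ) (hm₁ : 0 < m₁)
    (hm₂ : 0 < m₂) :
    ∃ C : ℝ, 0 < C ∧
      ∀ (R : ℝ) (f u : En n → ℝ), 0 < R → C1AwayFromZero f → CondA2 θ m₁ m₂ m₃ f →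
        IsSolution f u R →
        ‖gradient u 0‖ ^ 2 ≤
          max (Real.exp (C / R ^ (1 / (θ - 1))) - 1) (C / R ^ (2 / (2 * θ - 1))) := by
  have hθ1 : 0 < θ - 1 := by linarith
  -- Sized for the exponent `θ - 1` of large values; the exponent `θ - 1 / 2` of small values is
  -- larger, so the same `k` serves both.
  set k := 1 / (θ - 1) with hk
  have hkpos : 0 < k := by positivity
  set B := 2 * k * (1 / √m₁ + 1) with hB
  set D := 4 * k ^ 2 + k * (2 * n + 4) with hD
  set M := (B + D) / (2 / n) + 1 with hM
  have hMpos : 0 < M := by positivity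
  set A := 2 * M / √m₂ with hA
  refine ⟨(2 * A) ^ (1 / (θ - 1)) + 2 * (2 * A) ^ (1 / (θ - 1 / 2)), by positivity,
    fun R f u hR hf hcond hu => ?_⟩
  have hC1 : 0 < (2 * A) ^ (1 / (θ - 1)) := by positivity
  have hC2 : 0 < (2 * A) ^ (1 / (θ - 1 / 2)) := by positivity
  by_cases h0 : gradient u 0 = 0
  · refine le_max_of_le_right ?_
    rw [h0, norm_zero, zero_pow two_ne_zero]
    positivity
  obtain ⟨x, p, a, ζ, η, τ, -, hp, hη, hη1, hle, hζ, ha, hineq, hτ, -⟩ :=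
    hu.exists_point_log_log hR (fun p hp => hf.differentiableAt hp) h0 hkpos
      (h := fun _ => 0) (h₁ := fun _ => 0) (h₂ := fun _ => 0)
      (fun _ _ => hasDerivAt_const _ _) (fun _ _ => hasDerivAt_const _ _)
  simp only [zero_smul, sub_zero] at hζ
  subst hζ
  simp only [Real.exp_zero, mul_one, zero_mul, add_zero] at hle hineq
  have hn := natCast_pos_of_ne_zero hp
  have hz := log_one_add_pos (s := ‖p‖ ^ 2) (by positivity)
  have hz₀ := log_one_add_pos (s := ‖gradient u 0‖ ^ 2) (by positivity)
  obtain ⟨hcond, -⟩ := hcond p hp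
  have hexp : ‖gradient u 0‖ ^ 2 = Real.exp (Real.log (1 + ‖gradient u 0‖ ^ 2)) - 1 := by
    rw [Real.exp_log (by positivity)]; ring
  rw [hexp]
  set z := Real.log (1 + ‖p‖ ^ 2)
  set z₀ := Real.log (1 + ‖gradient u 0‖ ^ 2)
  set δ := (R / 2 * η)⁻¹ with hδ
  have hδpos : 0 < δ := by positivity
  have hW : 0 < √(1 + ‖p‖ ^ 2) := Real.sqrt_pos.2 (by positivity)
  have hW2 : √(1 + ‖p‖ ^ 2) ^ 2 = 1 + ‖p‖ ^ 2 := Real.sq_sqrt (by positivity)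
  set W := √(1 + ‖p‖ ^ 2)
  have hsz : 0 < √z := Real.sqrt_pos.2 hz
  have hsz2 : √z ^ 2 = z := Real.sq_sqrt hz.le
  set Y := |f p| / √z with hY
  have hY0 : 0 ≤ Y := by positivity
  have hfY : |f p| = Y * √z := by rw [hY]; field_simp
  have hgrad : W * ‖gradient f p‖ ≤ Y / √m₁ := by
    rw [hY, le_div_iff₀ (by positivity), le_div_iff₀ hsz]
    refine abs_le_of_sq_le_sq' ?_ (abs_nonneg _) |>.2
    have : 0 ≤ m₂ * z ^ (2 * θ) := by positivity
    rw [sq_abs, mul_pow, mul_pow, mul_pow, Real.sq_sqrt hm₁.le, hW2, hsz2]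
    linarith
  have hquad : 2 / n * Y ^ 2 ≤ B * ((1 + √z) * δ) * Y + D * ((1 + √z) * δ) ^ 2 := by
    have e1 : 2 / n * Y ^ 2 ≤ 2 * τ / z := by
      rw [hY, div_pow, hsz2, sq_abs, ← mul_div_assoc]
      gcongr ?_ / _
      rw [div_mul_eq_mul_div, div_le_iff₀ hn]
      linarith
    have e2 : -(2 * k * δ * (Y / √m₁)) ≤ W * inner ℝ (gradient f p) ζ := by
      refine (neg_le_neg ?_).trans (neg_abs_le _)
      rw [abs_mul, abs_of_pos hW]
      calc W * |inner ℝ (gradient f p) ζ| ≤ W * (‖gradient f p‖ * ‖ζ‖) := by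
            gcongr; exact abs_real_inner_le_norm _ _
        _ = ‖ζ‖ * (W * ‖gradient f p‖) := by ring
        _ ≤ _ := by gcongr
    have e3 : -(2 * k * δ * (Y * √z)) ≤ f p * inner ℝ p ζ / W := by
      refine (neg_le_neg ?_).trans (neg_abs_le _)
      rw [mul_div_assoc, abs_mul, mul_comm, hfY]
      gcongr
      exact (abs_inner_div_sqrt_le p ζ).trans ha
    have e4 : graphForm p ζ ≤ 4 * k ^ 2 * δ ^ 2 := by
      refine (graphForm_le p ζ).trans ?_
      calc ‖ζ‖ ^ 2 ≤ (2 * k * δ) ^ 2 := by gcongr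
        _ = _ := by ring
    have e5 : 2 * k * δ * (Y / √m₁) + 2 * k * δ * (Y * √z) ≤ B * ((1 + √z) * δ) * Y := by
      have : 0 ≤ 2 * k * δ * (Y / √m₁) * √z + 2 * k * δ * Y := by positivity
      have e : B * ((1 + √z) * δ) * Y = 2 * k * δ * (Y / √m₁) + 2 * k * δ * (Y * √z)
        + (2 * k * δ * (Y / √m₁) * √z + 2 * k * δ * Y) := by rw [hB]; ring
      linarith
    have e6 : 4 * k ^ 2 * δ ^ 2 + k * (2 * n + 4) * δ ^ 2 ≤ D * ((1 + √z) * δ) ^ 2 := by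
      rw [← add_mul, ← hD]
      gcongr
      exact le_mul_of_one_le_left hδpos.le (by linarith)
    linarith
  have hYM : Y ≤ M * ((1 + √z) * δ) :=
    le_mul_of_quadratic_le (by positivity) (by positivity) (by positivity) (by positivity) hquad
  have hzθ : √m₂ * z ^ (θ - 1 / 2) ≤ M * ((1 + √z) * δ) := by
    refine le_trans ?_ hYM
    rw [hY, le_div_iff₀ hsz, mul_assoc, Real.sqrt_eq_rpow z, ← Real.rpow_add hz, sub_add_cancel]
    refine abs_le_of_sq_le_sq' ?_ (abs_nonneg _) |>.2
    have : 0 ≤ m₁ * (1 + ‖p‖ ^ 2) * z * ‖gradient f p‖ ^ 2 := by positivity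
    rw [sq_abs, mul_pow, Real.sq_sqrt hm₂.le, ← Real.rpow_natCast (z ^ θ), ← Real.rpow_mul hz.le]
    rw [show θ * ((2 : ℕ) : ℝ) = 2 * θ by push_cast; ring]
    linarith
  -- The factor `1 + √z` is bounded for small `z` and costs half a power of `z` for large `z`,
  -- whence the two members of the maximum.
  rcases le_total z 1 with hz1 | hz1
  · refine le_max_of_le_right ?_
    have h1 : z ^ (θ - 1 / 2) ≤ A * δ := by
      rw [hA, div_mul_eq_mul_div, le_div_iff₀ (by positivity), mul_comm]
      refine hzθ.trans ?_
      have : √z ≤ 1 := Real.sqrt_le_one.2 hz1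
      calc M * ((1 + √z) * δ) ≤ M * ((1 + 1) * δ) := by gcongr
        _ = _ := by ring
    have h2 := le_of_cutoff_rpow_le hz₀.le hz.le hη hη1 (by linarith)
      (by rw [hk, one_div_mul_eq_div, le_div_iff₀ hθ1]; linarith) (by positivity) hR hle h1
    have h3 : z₀ ≤ 1 := hle.trans (mul_le_one₀ (Real.rpow_le_one hη.le hη1 hkpos.le) hz.le hz1)
    -- As `z₀ ≤ 1`, `exp z₀ - 1 ≤ 2 * z₀`; this is the factor 2 in the constant.
    have h4 := Real.abs_exp_sub_one_le (x := z₀) (by rwa [abs_of_pos hz₀])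
    rw [abs_of_pos hz₀] at h4
    have h5 := (le_abs_self _).trans h4
    have h6 : (2 : ℝ) / (2 * θ - 1) = 1 / (θ - 1 / 2) := by
      have : 2 * θ - 1 ≠ 0 := by linarith
      have : θ - 1 / 2 ≠ 0 := by linarith
      field_simp
    rw [h6, add_div]
    have : 0 ≤ (2 * A) ^ (1 / (θ - 1)) / R ^ (1 / (θ - 1 / 2)) := by positivity
    rw [mul_div_assoc]
    linarith
  · refine le_max_of_le_left ?_
    have h1 : z ^ (θ - 1) ≤ A * δ := by
      have hs1 : 1 ≤ √z := Real.one_le_sqrt.2 hz1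
      have e : z ^ (θ - 1 / 2) = z ^ (θ - 1) * √z := by
        rw [Real.sqrt_eq_rpow, ← Real.rpow_add hz]; congr 1; ring
      rw [e] at hzθ
      rw [hA, div_mul_eq_mul_div, le_div_iff₀ (by positivity), mul_comm]
      refine le_of_mul_le_mul_right (?_ : _ * √z ≤ _ * √z) hsz
      calc _ = √m₂ * (z ^ (θ - 1) * √z) := by ring
        _ ≤ M * ((1 + √z) * δ) := hzθ
        _ ≤ M * ((√z + √z) * δ) := by gcongr
        _ = _ := by ring
    have h2 := le_of_cutoff_rpow_le hz₀.le hz.le hη hη1 hθ1 (by rw [hk]; field_simp; rfl)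
      (by positivity) hR hle h1
    gcongr
    refine h2.trans ?_
    gcongr
    linarith

end PowerAndLogGrowth

/-! ### A logarithmic bound through the oscillation, common to (d) and (e). -/

noncomputable section OscillationBounds

open Filter Topology

variable {n : ℕ} {u f : En n → ℝ} {R : ℝ}

lemma hasDerivAt_neg_mul_log {β c σ s : ℝ} (hs : 0 < c + σ * s) :
    HasDerivAt (fun s => -(β * Real.log (c + σ * s))) (-(β * σ / (c + σ * s))) s := by
  refine ((((((hasDerivAt_id' s).const_mul σ).const_add c).log hs.ne').const_mul β).fun_neg).congr_deriv
    ?_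
  ring

lemma hasDerivAt_neg_div {β c σ s : ℝ} (hs : 0 < c + σ * s) :
    HasDerivAt (fun s => -(β * σ / (c + σ * s))) (β * σ ^ 2 / (c + σ * s) ^ 2) s := by
  refine ((((((hasDerivAt_id' s).const_mul σ).const_add c).fun_inv hs.ne').const_mul
    (-(β * σ))).congr_deriv ?_).congr_of_eventuallyEq (.of_forall fun t => ?_)
  · ring
  · simp only [div_eq_mul_inv]
    ring

/-- The price of comparing the weight `exp (h (u))` at the maximum point and at the centre; 3
replaces `exp 1`. -/
lemma exp_neg_mul_log_le {β φ φ₀ : ℝ} (hβ : 0 ≤ β) (hβ1 : β ≤ 1) (hφ : 0 < φ) (hφ₀ : 0 < φ₀)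
    (h : φ₀ ≤ 2 * φ) : Real.exp (-(β * Real.log φ)) ≤ 3 * Real.exp (-(β * Real.log φ₀)) := by
  have h1 : Real.log φ₀ ≤ Real.log φ + 1 := by
    have := Real.log_le_log hφ₀ h
    rw [Real.log_mul two_ne_zero hφ.ne'] at this
    linarith [Real.log_two_lt_d9]
  have h2 : -(β * Real.log φ) ≤ 1 + -(β * Real.log φ₀) := by nlinarith
  calc Real.exp (-(β * Real.log φ)) ≤ Real.exp (1 + -(β * Real.log φ₀)) := Real.exp_le_exp.2 h2
    _ = Real.exp 1 * Real.exp (-(β * Real.log φ₀)) := Real.exp_add _ _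
    _ ≤ _ := by
      gcongr
      linarith [Real.exp_one_lt_d9]

lemma abs_sub_le_of_isLUB {L : ℝ} (hR : 0 < R) (hL : IsLUB (oscillationSet u R) L) {x : En n}
    (hx : x ∈ ballR n R) : |u x - u 0| ≤ L :=
  hL.1 ⟨x, hx, 0, Metric.mem_ball_self hR, rfl⟩

lemma nonneg_of_isLUB {L : ℝ} (hR : 0 < R) (hL : IsLUB (oscillationSet u R) L) : 0 ≤ L :=
  (abs_nonneg _).trans (abs_sub_le_of_isLUB hR hL (Metric.mem_ball_self hR))

lemma log_one_add_le {s : ℝ} (hs : 0 ≤ s) : Real.log (1 + s) ≤ s := by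
  linarith [Real.log_le_sub_one_of_pos (show 0 < 1 + s by linarith)]

/-- Bounds for the form `graphForm p (a - c p)` from both sides. -/
lemma graphForm_sub_smul_bounds (p a : En n) (c : ℝ) :
    graphForm p (a - c • p) ≤ 2 * ‖a‖ ^ 2 + 2 * (c ^ 2 * (‖p‖ ^ 2 / (1 + ‖p‖ ^ 2))) ∧
    c ^ 2 * (‖p‖ ^ 2 / (1 + ‖p‖ ^ 2)) - 2 * |c| * ‖a‖ / √(1 + ‖p‖ ^ 2)
      ≤ graphForm p (a - c • p) := by
  have hplus := graphForm_nonneg p (a - (-c) • p)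
  have hT := graphForm_le p a
  have hT0 := graphForm_nonneg p a
  rw [graphForm_sub_smul] at hplus ⊢
  have hW : 0 < √(1 + ‖p‖ ^ 2) := Real.sqrt_pos.2 (by positivity)
  have hW2 : √(1 + ‖p‖ ^ 2) ^ 2 = 1 + ‖p‖ ^ 2 := Real.sq_sqrt (by positivity)
  have e : 2 * -c * inner ℝ p a / (1 + ‖p‖ ^ 2) = - (2 * c * inner ℝ p a / (1 + ‖p‖ ^ 2)) := by ring
  rw [e, neg_sq] at hplus
  have hcross : 2 * c * inner ℝ p a / (1 + ‖p‖ ^ 2) ≤ 2 * |c| * ‖a‖ / √(1 + ‖p‖ ^ 2) := by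
    have h1 := abs_inner_div_sqrt_le p a
    have h2 : 2 * c * inner ℝ p a / (1 + ‖p‖ ^ 2) =
        2 * (c * (inner ℝ p a / √(1 + ‖p‖ ^ 2))) / √(1 + ‖p‖ ^ 2) := by
      rw [← hW2, Real.sqrt_sq hW.le]; field_simp
    rw [h2, mul_assoc 2]
    gcongr 2 * ?_ / _
    refine (le_abs_self _).trans ?_
    rw [abs_mul]
    gcongr
  constructor
  · linarith
  · linarith

/-- The scalar inequality behind the oscillation bound, with `q = |p|² / (1 + |p|²)`. -/
lemma absorb_gradient_terms {n' m₁ g δ H q T z h₂ E β : ℝ} (hn : 0 < n') (hm₁ : 0 < m₁)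
    (hq : 0 ≤ q) (hβ : β = (3 + n' * (1 / √m₁ + 1) ^ 2 / 2)⁻¹) (hh₂ : h₂ = H ^ 2 / β)
    (hT : T ≤ 32 * δ ^ 2 + 2 * (H ^ 2 * q))
    (h : g ^ 2 / n' + T * z / 4 - T + h₂ * q ≤ (4 * n' + 8) * δ ^ 2 +
      g / √m₁ * (4 * δ + H * √q) + g * (H * √q) + E) :
    T * z / 4 + H ^ 2 * q ≤ (4 * n' + 40 + 8 * n' / m₁) * δ ^ 2 + E := by
  have hs : 0 < √m₁ := Real.sqrt_pos.2 hm₁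
  have hs2 : √m₁ ^ 2 = m₁ := Real.sq_sqrt hm₁.le
  have hq2 : √q ^ 2 = q := Real.sq_sqrt hq
  have e1 : g / √m₁ * (4 * δ + H * √q) + g * (H * √q) ≤
      g ^ 2 / n' + (8 * n' / m₁) * δ ^ 2 + n' * (1 / √m₁ + 1) ^ 2 / 2 * (H ^ 2 * q) := by
    -- The difference of the two sides of `e1`, written as a sum of squares.
    have key : 0 ≤ (g - n' / 2 * (4 * δ / √m₁ + (1 / √m₁ + 1) * (H * √q))) ^ 2 / n'
      + n' / 4 * (4 * δ / √m₁ - (1 / √m₁ + 1) * (H * √q)) ^ 2 := by positivity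
    rw [← sub_nonneg]
    refine key.trans_eq ?_
    rw [← hs2, ← hq2, Real.sqrt_sq hs.le, Real.sqrt_sq (Real.sqrt_nonneg q)]
    field_simp
    ring
  have e2 : h₂ * q = 3 * (H ^ 2 * q) + n' * (1 / √m₁ + 1) ^ 2 / 2 * (H ^ 2 * q) := by
    rw [hh₂, hβ, div_inv_eq_mul]; ring
  linarith

/-- If `16 δ ≤ W H`, the last term of `hmain` is absorbed in the left side. Otherwise `z ≤ 2 W ≤ 32
δ / H`, which is already a bound. -/
lemma le_of_oscillation_inequality {β D m₂ N H δ z W : ℝ} (hβ : 0 < β) (hD : 0 < D) (hm₂ : 0 ≤ m₂)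
    (hN : 0 < N) (hHpos : 0 < H) (hδ : 0 < δ) (hz : 0 < z) (hW : 0 < W)
    (hHN : 1 / H ≤ 3 * N / β) (hzW : z ≤ 2 * W)
    (hmain : H ^ 2 * z ≤ 4 * D * δ ^ 2 + 16 * m₂ * δ + 8 * z * H * δ / W) :
    z ≤ (72 * D / β ^ 2 + 288 / β ^ 2 + 96 / β) * (N ^ 2 * δ ^ 2 + m₂ * N ^ 2 * δ + N * δ) := by
  have hsplit : (72 * D / β ^ 2 + 288 / β ^ 2 + 96 / β) * (N ^ 2 * δ ^ 2 + m₂ * N ^ 2 * δ + N * δ)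
      = (3 * N / β) ^ 2 * (8 * D * δ ^ 2 + 32 * m₂ * δ) + 96 / β * (N * δ)
      + (288 / β ^ 2 * (N ^ 2 * δ ^ 2) + 96 / β * (N ^ 2 * δ ^ 2)
        + 72 * D / β ^ 2 * (m₂ * N ^ 2 * δ) + 96 / β * (m₂ * N ^ 2 * δ)
        + 72 * D / β ^ 2 * (N * δ) + 288 / β ^ 2 * (N * δ)) := by
    ring
  have hrest : 0 ≤ 288 / β ^ 2 * (N ^ 2 * δ ^ 2) + 96 / β * (N ^ 2 * δ ^ 2)
        + 72 * D / β ^ 2 * (m₂ * N ^ 2 * δ) + 96 / β * (m₂ * N ^ 2 * δ)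
        + 72 * D / β ^ 2 * (N * δ) + 288 / β ^ 2 * (N * δ) := by positivity
  have hpos1 : 0 ≤ (3 * N / β) ^ 2 * (8 * D * δ ^ 2 + 32 * m₂ * δ) := by positivity
  have hpos2 : 0 ≤ 96 / β * (N * δ) := by positivity
  rcases le_total (16 * δ) (W * H) with hcase | hcase
  · have i1 : 8 * z * H * δ / W ≤ H ^ 2 * z / 2 := by
      rw [div_le_iff₀ hW]
      have := mul_le_mul_of_nonneg_left hcase (show 0 ≤ z * H / 2 by positivity)
      linarith
    have i2 : z ≤ (1 / H) ^ 2 * (8 * D * δ ^ 2 + 32 * m₂ * δ) := by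
      rw [div_pow, one_pow, one_div_mul_eq_div, le_div_iff₀ (by positivity)]
      linarith
    have i3 : (1 / H) ^ 2 * (8 * D * δ ^ 2 + 32 * m₂ * δ)
        ≤ (3 * N / β) ^ 2 * (8 * D * δ ^ 2 + 32 * m₂ * δ) := by gcongr
    linarith
  · have i1 : z ≤ 32 * δ * (1 / H) := by
      rw [mul_one_div, le_div_iff₀ hHpos]
      have := mul_le_mul_of_nonneg_right hzW hHpos.le
      linarith
    have i2 : 32 * δ * (1 / H) ≤ 32 * δ * (3 * N / β) := by gcongr
    have i3 : 32 * δ * (3 * N / β) = 96 / β * (N * δ) := by ring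
    linarith

lemma cutoff_sq_mul_le {C m₂ N R η δ z : ℝ} (hC : 0 < C) (hm₂ : 0 ≤ m₂) (hN : 0 < N) (hR : 0 < R)
    (hη : 0 < η) (hη1 : η ≤ 1) (hδ : δ = (R / 2 * η)⁻¹)
    (hz : z ≤ C * (N ^ 2 * δ ^ 2 + m₂ * N ^ 2 * δ + N * δ)) :
    3 * η ^ 2 * z ≤ 12 * C * (N ^ 2 / R ^ 2 + m₂ * N ^ 2 / R + N / R) := by
  have hηδ : η ^ 2 * δ ^ 2 = 4 / R ^ 2 := by rw [hδ]; field_simp; norm_num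
  have hηδ' : η ^ 2 * δ ≤ 2 / R := by
    have : η ^ 2 * δ = η * (2 / R) := by rw [hδ]; field_simp
    rw [this]
    exact mul_le_of_le_one_left (by positivity) hη1
  calc 3 * η ^ 2 * z ≤ 3 * η ^ 2 * (C * (N ^ 2 * δ ^ 2 + m₂ * N ^ 2 * δ + N * δ)) := by gcongr
    _ = 3 * C * (N ^ 2 * (η ^ 2 * δ ^ 2) + m₂ * N ^ 2 * (η ^ 2 * δ) + N * (η ^ 2 * δ)) := by ring
    _ ≤ 3 * C * (N ^ 2 * (4 / R ^ 2) + m₂ * N ^ 2 * (2 / R) + N * (2 / R)) := by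
      rw [hηδ]; gcongr
    _ ≤ _ := by
      rw [← sub_nonneg]
      have : 0 ≤ 6 * C * (m₂ * N ^ 2 / R + N / R) := by positivity
      refine this.trans_eq ?_
      ring

/-- The constant is independent of `m₂`, and `m₂ = 0` is allowed, so that (e) follows with `N = L`
and (d) with `N = L + 1`. -/
lemma log_bound_of_oscillation (n : ℕ) (m₁ : ℝ) (hm₁ : 0 < m₁) :
    ∃ C : ℝ, 0 < C ∧
      ∀ (m₂ R : ℝ) (f u : En n → ℝ) (L N : ℝ), 0 ≤ m₂ → 0 < R →
        (∀ p ≠ 0, DifferentiableAt ℝ f p) → CondA4 m₁ m₂ f →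
        IsSolution f u R → IsLUB (oscillationSet u R) L → L ≤ N → 0 < N →
        Real.log (1 + ‖gradient u 0‖ ^ 2) ≤ C * (N ^ 2 / R ^ 2 + m₂ * N ^ 2 / R + N / R) := by
  -- With `H = β / φ` one has `h'' = H² / β`. Of the summand 3, two units absorb `graphForm p ζ` and
  -- one survives; the other summand absorbs the terms in `f` and `∇f`.
  set β : ℝ := (3 + n * (1 / √m₁ + 1) ^ 2 / 2)⁻¹ with hβ
  have hβpos : 0 < β := by positivity
  have hβ1 : β ≤ 1 := by
    have : 0 ≤ n * (1 / √m₁ + 1) ^ 2 / 2 := by positivity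
    exact inv_le_one_of_one_le₀ (by linarith)
  set D : ℝ := 4 * n + 40 + 8 * n / m₁ with hD
  have hDpos : 0 < D := by positivity
  set C' : ℝ := 72 * D / β ^ 2 + 288 / β ^ 2 + 96 / β with hC'
  have hC'pos : 0 < C' := by positivity
  refine ⟨12 * C', by positivity, fun m₂ R f u L N hm₂ hR hf hcond hu hL hLN hN => ?_⟩
  by_cases h0 : gradient u 0 = 0
  · rw [h0]; simp; positivity
  have hL0 := nonneg_of_isLUB hR hL
  -- This places `φ = c + u` in `[N, 3 N]`, with value `N + L ≤ 2 N` at the centre.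
  set c := N + L - u 0 with hc
  have hφ : ∀ x ∈ ballR n R, N ≤ c + 1 * u x ∧ c + 1 * u x ≤ 3 * N := by
    intro x hx
    have := abs_le.1 (abs_sub_le_of_isLUB hR hL hx)
    constructor <;> linarith
  obtain ⟨x, p, a, ζ, η, τ, hx, hp, hη, hη1, hle, hζ, ha, hineq, hτ, hτ', -⟩ :=
    hu.exists_point_log_log hR hf h0 (k := 2) two_pos
      (h₁ := fun s => -(β * 1 / (c + 1 * s))) (h₂ := fun s => β * 1 ^ 2 / (c + 1 * s) ^ 2)
      (fun y hy => hasDerivAt_neg_mul_log (β := β) (hN.trans_le (hφ y hy).1))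
      (fun y hy => hasDerivAt_neg_div (β := β) (hN.trans_le (hφ y hy).1))
  obtain ⟨hφN, hφ3⟩ := hφ x hx
  have hφ0 : c + 1 * u 0 ≤ 2 * (c + 1 * u x) := by rw [hc] at hφN ⊢; linarith
  have hexp := exp_neg_mul_log_le hβpos.le hβ1 (hN.trans_le hφN)
    (hN.trans_le (hφ 0 (Metric.mem_ball_self hR)).1) hφ0
  set φ := c + 1 * u x
  have hφpos : 0 < φ := hN.trans_le hφN
  have hn := natCast_pos_of_ne_zero hp
  have hv : 0 < ‖p‖ ^ 2 := by positivity
  have hz := log_one_add_pos hv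
  have hzv := log_one_add_le hv.le
  obtain ⟨hcond, hfm⟩ := hcond p hp
  set z := Real.log (1 + ‖p‖ ^ 2)
  set z₀ := Real.log (1 + ‖gradient u 0‖ ^ 2)
  set δ := (R / 2 * η)⁻¹ with hδ
  have hδpos : 0 < δ := by positivity
  have hW : 0 < √(1 + ‖p‖ ^ 2) := Real.sqrt_pos.2 (by positivity)
  have hW2 : √(1 + ‖p‖ ^ 2) ^ 2 = 1 + ‖p‖ ^ 2 := Real.sq_sqrt (by positivity)
  have hW1 : 1 ≤ √(1 + ‖p‖ ^ 2) := Real.one_le_sqrt.2 (by linarith)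
  have hzW : z ≤ 2 * √(1 + ‖p‖ ^ 2) := by
    have := Real.log_le_sub_one_of_pos hW
    rw [Real.log_sqrt (by positivity)] at this
    linarith
  obtain ⟨hTle, hTge⟩ := graphForm_sub_smul_bounds p a (-(β * 1 / φ))
  rw [← hζ] at hTle hTge
  have hpin : inner ℝ p ζ = inner ℝ p a + β * 1 / φ * ‖p‖ ^ 2 := by
    rw [hζ, inner_sub_right, real_inner_smul_right, real_inner_self_eq_norm_sq]; ring
  set H := β * 1 / φ with hH
  have hHpos : 0 < H := by positivity
  have hζn : ‖ζ‖ ≤ 4 * δ + H * ‖p‖ := by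
    rw [hζ]
    refine (norm_sub_le _ _).trans ?_
    rw [norm_smul, Real.norm_eq_abs, abs_neg, abs_of_pos hHpos]
    linarith
  rw [abs_neg, abs_of_pos hHpos, neg_sq] at hTge
  rw [neg_sq] at hTle
  set W := √(1 + ‖p‖ ^ 2)
  set q := ‖p‖ ^ 2 / (1 + ‖p‖ ^ 2) with hq
  have hqpos : 0 < q := by positivity
  have hsq : √q = ‖p‖ / W := by rw [hq, Real.sqrt_div' _ (by positivity), Real.sqrt_sq (norm_nonneg _)]
  have hsz : 0 < √z := Real.sqrt_pos.2 hz
  have hsz2 : √z ^ 2 = z := Real.sq_sqrt hz.le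
  have hszp : √z ≤ ‖p‖ := Real.sqrt_le_iff.2 ⟨norm_nonneg _, hzv⟩
  set g := |f p| / √z with hg
  have hg0 : 0 ≤ g := by positivity
  have hfg : |f p| = g * √z := by rw [hg]; field_simp
  have hgrad : W * ‖gradient f p‖ ≤ g / √m₁ / W := by
    rw [hg, le_div_iff₀ hW, le_div_iff₀ (by positivity), le_div_iff₀ hsz]
    refine abs_le_of_sq_le_sq' ?_ (abs_nonneg _) |>.2
    rw [sq_abs]
    calc _ = m₁ * (W ^ 2) ^ 2 * √z ^ 2 * ‖gradient f p‖ ^ 2 * (√m₁ ^ 2 / m₁) := by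
          field_simp
      _ = m₁ * (1 + ‖p‖ ^ 2) ^ 2 * z * ‖gradient f p‖ ^ 2 := by
          rw [hW2, hsz2, Real.sq_sqrt hm₁.le, div_self hm₁.ne', mul_one]
      _ ≤ _ := by linarith
  have hmain : H ^ 2 * z ≤ 4 * D * δ ^ 2 + 16 * m₂ * δ + 8 * z * H * δ / W := by
    -- Half of the `τ` term yields `f²`; the other half keeps a multiple of `graphForm p ζ`, the
    -- only term with an extra factor `z`.
    have e1 : g ^ 2 / n + graphForm p ζ * z / 4 ≤ 2 * τ / z := by
      have i1 : g ^ 2 / n ≤ τ / z := by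
        rw [hg, div_pow, hsz2, sq_abs, div_div, mul_comm, ← div_div]
        gcongr
        rw [div_le_iff₀ hn]; linarith
      have i2 : graphForm p ζ * z / 4 ≤ τ / z := by
        rw [le_div_iff₀ hz]; linarith
      have i3 : 2 * τ / z = τ / z + τ / z := by ring
      linarith
    have e2 : -(g / √m₁ * (4 * δ + H * √q)) ≤ W * inner ℝ (gradient f p) ζ := by
      refine (neg_le_neg ?_).trans (neg_abs_le _)
      rw [abs_mul, abs_of_pos hW]
      calc W * |inner ℝ (gradient f p) ζ| ≤ W * (‖gradient f p‖ * ‖ζ‖) := by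
            gcongr; exact abs_real_inner_le_norm _ _
        _ = (W * ‖gradient f p‖) * ‖ζ‖ := by ring
        _ ≤ g / √m₁ / W * (4 * δ + H * ‖p‖) := by gcongr
        _ = g / √m₁ * (4 * δ / W + H * √q) := by rw [hsq]; field_simp
        _ ≤ _ := by
          gcongr
          exact div_le_self (by positivity) hW1
    have e3 : -(4 * m₂ * δ) - g * (H * √q) ≤ f p * inner ℝ p ζ / W + -H * (W * f p) := by
      -- The parts of order `H * W * f` cancel, because `|p|² - W² = -1`.
      have i1 : f p * inner ℝ p ζ / W + -H * (W * f p)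
          = f p * (inner ℝ p a / W) - f p * (H / W) := by
        have : W * f p = f p * (W ^ 2) / W := by field_simp
        rw [this, hpin, hW2]; field_simp; ring
      have i2 : |f p * (inner ℝ p a / W)| ≤ 4 * m₂ * δ := by
        rw [abs_mul]
        calc |f p| * |inner ℝ p a / W| ≤ m₂ * (2 * 2 * δ) := by
              gcongr
              exact (abs_inner_div_sqrt_le p a).trans ha
          _ = _ := by ring
      have i3 : |f p * (H / W)| ≤ g * (H * √q) := by
        rw [abs_mul, abs_of_pos (show 0 < H / W by positivity), hfg, hsq]
        calc g * √z * (H / W) ≤ g * ‖p‖ * (H / W) := by gcongr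
          _ = _ := by ring
      rw [i1]
      linarith [neg_abs_le (f p * (inner ℝ p a / W)), le_abs_self (f p * (H / W))]
    have e4 : graphForm p ζ ≤ 32 * δ ^ 2 + 2 * (H ^ 2 * q) := by
      refine hTle.trans ?_
      have : ‖a‖ ^ 2 ≤ (2 * 2 * δ) ^ 2 := by gcongr
      linarith
    have e5 := absorb_gradient_terms (g := g) (E := 4 * m₂ * δ) (z := z) hn hm₁ hqpos.le hβ
      (show β * 1 ^ 2 / φ ^ 2 = H ^ 2 / β by rw [hH]; field_simp) e4 (by linarith)
    rw [← hD] at e5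
    have e6 : H ^ 2 * q - 8 * H * δ / W ≤ graphForm p ζ := by
      have i1 : 2 * H * ‖a‖ / W ≤ 2 * H * (2 * 2 * δ) / W := by gcongr
      have i2 : 2 * H * (2 * 2 * δ) / W = 8 * H * δ / W := by ring
      linarith
    -- Equivalent to `z ≤ 4 |p|²`; it keeps the estimate valid for small gradients, where `q`
    -- degenerates.
    have e7 : z ≤ q * (4 + z) := by
      rw [hq, div_mul_eq_mul_div, le_div_iff₀ (by positivity)]
      linarith
    have e8 := mul_le_mul_of_nonneg_left e7 (sq_nonneg H)
    have e9 := mul_le_mul_of_nonneg_right e6 hz.le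
    have e10 : 8 * z * H * δ / W = 8 * H * δ / W * z := by ring
    rw [e10]
    linarith
  have hHN : 1 / H ≤ 3 * N / β := by
    rw [hH, mul_one, one_div_div]
    gcongr
  have hzbound : z ≤ C' * (N ^ 2 * δ ^ 2 + m₂ * N ^ 2 * δ + N * δ) := by
    exact le_of_oscillation_inequality hβpos hDpos hm₂ hN hHpos hδpos hz hW hHN hzW hmain
  have hfin : z₀ ≤ 3 * η ^ 2 * z := by
    have : z₀ * Real.exp (-(β * Real.log (c + 1 * u 0))) ≤
        3 * η ^ 2 * z * Real.exp (-(β * Real.log (c + 1 * u 0))) := by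
      refine hle.trans ?_
      rw [Real.rpow_two]
      calc _ ≤ η ^ 2 * (z * (3 * Real.exp (-(β * Real.log (c + 1 * u 0))))) := by gcongr
        _ = _ := by ring
    exact le_of_mul_le_mul_right this (Real.exp_pos _)
  exact hfin.trans (cutoff_sq_mul_le hC'pos hm₂ hN hR hη hη1 hδ hzbound)

end OscillationBounds

/-! ### Cases (d) and (e). -/

noncomputable section BoundedAndZero

open Filter Topology

variable {n : ℕ} {u : En n → ℝ} {R : ℝ}

lemma norm_gradient_sq_eq_exp (u : En n → ℝ) (x : En n) :
    ‖gradient u x‖ ^ 2 = Real.exp (Real.log (1 + ‖gradient u x‖ ^ 2)) - 1 := by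
  rw [Real.exp_log (by positivity)]; ring

/-- Interior gradient bound for bounded right-hand sides. -/
theorem gradient_bound_of_condA4 (n : ℕ) (m₁ m₂ : ℝ) (hm₁ : 0 < m₁) (hm₂ : 0 < m₂) :
    ∃ C : ℝ, 0 < C ∧
      ∀ (R : ℝ) (f u : En n → ℝ) (L : ℝ), 0 < R → C1AwayFromZero f → CondA4 m₁ m₂ f →
        IsSolution f u R → IsLUB (oscillationSet u R) L →
        ‖gradient u 0‖ ^ 2 ≤
          max (Real.exp (C * (L + 1) ^ 2 / R ^ 2) - 1)
            (Real.exp (C * (L + 1) ^ 2 / R ^ ((2 : ℝ) / 3)) - 1) := by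
  obtain ⟨C, hC, h⟩ := log_bound_of_oscillation n m₁ hm₁
  refine ⟨C * (2 + m₂), by positivity, fun R f u L hR hf hcond hu hL => ?_⟩
  have hL0 := nonneg_of_isLUB hR hL
  have hz := h m₂ R f u L (L + 1) hm₂.le hR (fun p hp => hf.differentiableAt hp) hcond hu hL
    (by linarith) (by linarith)
  have hN : L + 1 ≤ (L + 1) ^ 2 := by nlinarith
  have hN0 : 0 < L + 1 := by linarith
  generalize L + 1 = N at *
  have key : ∀ t, 0 < t → t ≤ R → t ≤ R ^ 2 →
      Real.log (1 + ‖gradient u 0‖ ^ 2) ≤ C * (2 + m₂) * N ^ 2 / t := by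
    intro t ht h1 h2
    calc _ ≤ C * (N ^ 2 / R ^ 2 + m₂ * N ^ 2 / R + N / R) := hz
      _ ≤ C * (N ^ 2 / t + m₂ * N ^ 2 / t + N ^ 2 / t) := by gcongr
      _ = _ := by ring
  rw [norm_gradient_sq_eq_exp]
  -- For `R ≤ 1` the power `R⁻²` dominates; for `R ≥ 1` every term is at most of order `1 / R`,
  -- hence of order `R ^ (-2 / 3)`.
  rcases le_total R 1 with hR1 | hR1
  · refine le_max_of_le_left ?_
    gcongr
    exact key _ (by positivity) (by nlinarith) le_rfl
  · refine le_max_of_le_right ?_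
    gcongr
    have h1 : R ^ ((2 : ℝ) / 3) ≤ R := by
      simpa using Real.rpow_le_rpow_of_exponent_le hR1 (show (2 : ℝ) / 3 ≤ 1 by norm_num)
    exact key _ (by positivity) h1 (h1.trans (by nlinarith))

lemma gradient_eq_zero_of_oscillation_eq_zero (hR : 0 < R) (hL : IsLUB (oscillationSet u R) 0) :
    gradient u 0 = 0 := by
  have hc : u =ᶠ[𝓝 0] fun _ => u 0 := by
    filter_upwards [Metric.ball_mem_nhds (0 : En n) hR] with x hx
    have := abs_sub_le_of_isLUB hR hL hx
    exact sub_eq_zero.1 (abs_eq_zero.1 (le_antisymm this (abs_nonneg _)))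
  have : fderiv ℝ u 0 = 0 := by rw [hc.fderiv_eq]; simp
  simp [gradient, this]

/-- Interior gradient bound for the minimal surface equation. -/
theorem gradient_bound_of_zero (n : ℕ) :
    ∃ C : ℝ, 0 < C ∧
      ∀ (R : ℝ) (u : En n → ℝ) (L : ℝ), 0 < R →
        IsSolution (fun _ => 0) u R → IsLUB (oscillationSet u R) L →
        ‖gradient u 0‖ ^ 2 ≤
          max (Real.exp (C * L ^ 2 / R ^ 2) - 1) (Real.exp (C * L / R) - 1) := by
  obtain ⟨C, hC, h⟩ := log_bound_of_oscillation n 1 one_pos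
  refine ⟨C * 2, by positivity, fun R u L hR hu hL => ?_⟩
  have hL0 := nonneg_of_isLUB hR hL
  -- The logarithmic weight needs `N = L > 0`, so constant `u` is treated apart.
  rcases hL0.eq_or_lt with rfl | hLpos
  · rw [gradient_eq_zero_of_oscillation_eq_zero hR hL]
    simp
  have hcond : CondA4 (n := n) 1 0 (fun _ => 0) := by
    intro p _
    simp [gradient]
  have hz := h 0 R _ u L L le_rfl hR (fun p hp => differentiableAt_const _) hcond hu hL le_rfl hLpos
  have e : C * (L ^ 2 / R ^ 2 + 0 * L ^ 2 / R + L / R) = C * ((L / R) ^ 2 + L / R) := by ring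
  rw [e] at hz
  rw [norm_gradient_sq_eq_exp]
  have e1 : C * 2 * L ^ 2 / R ^ 2 = C * ((L / R) ^ 2 + (L / R) ^ 2) := by ring
  have e2 : C * 2 * L / R = C * (L / R + L / R) := by ring
  rw [e1, e2]
  have ht : 0 < L / R := by positivity
  generalize L / R = t at *
  rcases le_total t 1 with ht1 | ht1
  · refine le_max_of_le_right ?_
    gcongr
    refine hz.trans ?_
    gcongr
    nlinarith
  · refine le_max_of_le_left ?_
    gcongr
    refine hz.trans ?_
    gcongr
    nlinarith

end BoundedAndZero

/-! ### Case (c): sign of `f` and the inequality at the maximum. -/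

noncomputable section ExactLogGrowth

open Filter Topology

variable {n : ℕ} {u f : En n → ℝ} {R : ℝ}

/-- In dimension at least two a continuous function without zeros on `ℝⁿ \ {0}` has a sign. -/
lemma exists_sign_of_ne_zero (hn : 2 ≤ n) (hf : ContinuousOn f {p | p ≠ 0})
    (h : ∀ p ≠ 0, f p ≠ 0) : ∃ σ : ℝ, σ ^ 2 = 1 ∧ ∀ p ≠ 0, f p = σ * |f p| := by
  have hrank : 1 < Module.rank ℝ (En n) := by
    rw [← Module.finrank_eq_rank, finrank_euclideanSpace_fin]
    exact_mod_cast hn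
  have hconn : IsPreconnected {p : En n | p ≠ 0} :=
    (isConnected_compl_singleton_of_one_lt_rank hrank (0 : En n)).isPreconnected
  have hsame : ∀ p ≠ 0, ∀ p' ≠ 0, 0 < f p → 0 < f p' := by
    intro p hp p' hp' hpos
    by_contra! hle
    obtain ⟨x, hx, hx0⟩ := hconn.intermediate_value hp' hp hf ⟨hle, hpos.le⟩
    exact h x hx hx0
  by_cases hex : ∃ p ≠ 0, 0 < f p
  · obtain ⟨p, hp, hpos⟩ := hex
    refine ⟨1, by norm_num, fun p' hp' => ?_⟩
    rw [one_mul, abs_of_pos (hsame p hp p' hp' hpos)]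
  · push Not at hex
    refine ⟨-1, by norm_num, fun p hp => ?_⟩
    rw [abs_of_nonpos (hex p hp)]; ring

/-- Fixing the sign makes `f` explicit near `p`, so its gradient is a known multiple of `p`. -/
lemma CondA3.inner_gradient_eq {θ m σ : ℝ} (hcond : CondA3 θ m f)
    (hσ : ∀ p ≠ 0, f p = σ * |f p|) {p : En n} (hp : p ≠ 0) (w : En n) :
    inner ℝ (gradient f p) w =
      2 * θ / Real.log (1 + ‖p‖ ^ 2) * f p * (inner ℝ p w / (1 + ‖p‖ ^ 2)) := by
  have hz := log_one_add_pos (s := ‖p‖ ^ 2) (by positivity)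
  have heq : f =ᶠ[𝓝 p] fun p => σ * (m * Real.log (1 + ‖p‖ ^ 2) ^ θ) := by
    filter_upwards [isOpen_ne.mem_nhds hp] with y hy
    rw [hσ y hy, hcond y hy]
  have hd := ((((((hasFDerivAt_id p).norm_sq).const_add 1).log (by positivity)).rpow_const
    (p := θ) (Or.inl hz.ne')).const_mul m).const_mul σ
  have hd' := hd.congr_of_eventuallyEq heq
  rw [inner_gradient, hd'.fderiv, hσ p hp, hcond p hp]
  simp only [id]
  rw [Real.rpow_sub_one hz.ne']
  simp
  field_simp

/-- One-dimensional bound: the first order condition alone suffices. -/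
lemma log_bound_of_condA3_one {θ m : ℝ} (hθ : 0 < θ) (hm : 0 < m) {u f : En 1 → ℝ} (hR : 0 < R)
    (hf : C1AwayFromZero f) (hcond : CondA3 θ m f) (hu : IsSolution f u R)
    (h0 : gradient u 0 ≠ 0) :
    Real.log (1 + ‖gradient u 0‖ ^ 2) ≤ (2 * (2 / θ / m)) ^ (1 / θ) / R ^ (1 / θ) := by
  obtain ⟨x, p, a, ζ, η, τ, -, hp, hη, hη1, hle, hζ, ha, -, hτ, -, hτ'⟩ :=
    hu.exists_point_log_log hR (fun p hp => hf.differentiableAt hp) h0 (k := 1 / θ) (by positivity)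
      (h := fun _ => 0) (h₁ := fun _ => 0) (h₂ := fun _ => 0)
      (fun _ _ => hasDerivAt_const _ _) (fun _ _ => hasDerivAt_const _ _)
  simp only [zero_smul, sub_zero] at hζ
  subst hζ
  simp only [Real.exp_zero, mul_one] at hle
  have hτ' := hτ' rfl
  have hv : 0 < ‖p‖ ^ 2 := by positivity
  have hz := log_one_add_pos hv
  have hz₀ := log_one_add_pos (s := ‖gradient u 0‖ ^ 2) (by positivity)
  have hcond := hcond p hp
  -- From `1 + z + z² / 2 ≤ exp z`; it turns `4 |p|² τ ≤ |ζ|² z²` into `τ ≤ |ζ|² / 2`.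
  have hzv : Real.log (1 + ‖p‖ ^ 2) ^ 2 ≤ 2 * ‖p‖ ^ 2 := by
    have := Real.quadratic_le_exp_of_nonneg hz.le
    rw [Real.exp_log (by positivity)] at this
    linarith
  refine le_of_cutoff_rpow_le hz₀.le hz.le hη hη1 hθ (by field_simp; rfl) (by positivity) hR hle ?_
  set z := Real.log (1 + ‖p‖ ^ 2)
  set δ := (R / 2 * η)⁻¹ with hδ
  have hδpos : 0 < δ := by positivity
  have hf2 : |f p| ≤ 2 / θ * δ := by
    refine abs_le_of_sq_le_sq ?_ (by positivity)
    have h1 : ‖ζ‖ ^ 2 ≤ (2 * (1 / θ) * δ) ^ 2 := by gcongr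
    have h2 : 4 * ‖p‖ ^ 2 * f p ^ 2 ≤ (2 * (1 / θ) * δ) ^ 2 * (2 * ‖p‖ ^ 2) := by
      have h3 : f p ^ 2 ≤ τ := by simpa using hτ
      calc 4 * ‖p‖ ^ 2 * f p ^ 2 ≤ 4 * ‖p‖ ^ 2 * τ := by gcongr
        _ ≤ ‖ζ‖ ^ 2 * z ^ 2 := hτ'
        _ ≤ _ := by gcongr
    have h4 : 4 * f p ^ 2 ≤ (2 * (1 / θ) * δ) ^ 2 * 2 :=
      le_of_mul_le_mul_right (by linarith) hv
    have h5 : (2 / θ * δ) ^ 2 = (2 * (1 / θ) * δ) ^ 2 := by ring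
    rw [h5]
    nlinarith [sq_nonneg (2 * (1 / θ) * δ)]
  rw [div_mul_eq_mul_div, le_div_iff₀ hm, mul_comm, ← hcond]
  exact hf2

/-- Large values: both the quadratic and the exponential term are used. -/
lemma rpow_bound_of_large {n' m c B D N δ z X E : ℝ} (hn : 0 < n') (hm : 0 < m) (hc : 0 < c)
    (hB : 0 ≤ B) (hD : 0 ≤ D) (hN : 1 ≤ N) (hδ : 0 < δ) (hz : 0 < z) (hX : 0 < X) (hXz : X ≤ z)
    (hE : z ^ 3 ≤ 48 * E)
    (h : 2 * m ^ 2 * X ^ 2 / (n' * z) + c * X * E / (z * N) ≤ B * δ * X + D * δ ^ 2) :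
    X ≤ ((B + D) / √(m ^ 2 * c / (6 * n')) + 1) * √N * δ := by
  have hE0 : 0 < E := by
    have : 0 < z ^ 3 := by positivity
    linarith
  have hsN : 1 ≤ √N := Real.one_le_sqrt.2 hN
  set d := √(m ^ 2 * c / (6 * n')) with hd
  have hdpos : 0 < d := Real.sqrt_pos.2 (by positivity)
  have hd2 : d ^ 2 = m ^ 2 * c / (6 * n') := Real.sq_sqrt (by positivity)
  -- By the arithmetic-geometric mean inequality: the product of the two terms carries `1 / N`, so
  -- its square root costs only `√N`.
  have hamgm : d / √N * X ^ 2 ≤ 2 * m ^ 2 * X ^ 2 / (n' * z) + c * X * E / (z * N) := by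
    refine abs_le_of_sq_le_sq' ?_ (by positivity) |>.2
    have h1 : (d / √N * X ^ 2) ^ 2 = m ^ 2 * c / (6 * n' * N) * X ^ 3 * X := by
      rw [mul_pow, div_pow, hd2, Real.sq_sqrt (by linarith)]; field_simp
    have h2 : X ≤ 48 * E / z ^ 2 := by
      rw [le_div_iff₀ (by positivity)]
      calc X * z ^ 2 ≤ z * z ^ 2 := by gcongr
        _ = z ^ 3 := by ring
        _ ≤ _ := hE
    have h3 : m ^ 2 * c / (6 * n' * N) * X ^ 3 * (48 * E / z ^ 2) =
        4 * (2 * m ^ 2 * X ^ 2 / (n' * z)) * (c * X * E / (z * N)) := by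
      field_simp; norm_num
    rw [h1]
    calc m ^ 2 * c / (6 * n' * N) * X ^ 3 * X
        ≤ m ^ 2 * c / (6 * n' * N) * X ^ 3 * (48 * E / z ^ 2) := by gcongr
      _ = 4 * (2 * m ^ 2 * X ^ 2 / (n' * z)) * (c * X * E / (z * N)) := h3
      _ ≤ _ := four_mul_le_sq_add _ _
  have := le_mul_of_quadratic_le (c := d / √N) (by positivity) hB hD hδ.le (hamgm.trans h)
  refine this.trans ?_
  have e : (B + D) / (d / √N) + 1 ≤ ((B + D) / d + 1) * √N := by
    have : (B + D) / (d / √N) = (B + D) / d * √N := by field_simp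
    rw [this]; linarith
  gcongr

/-- The differential inequality at the maximum point, for `|f| = m logᶿ(1 + |p|²)` with a sign. -/
lemma exists_point_of_condA3 {θ m σ L Q : ℝ} (hθ : 0 < θ) (hσ : σ ^ 2 = 1)
    (hR : 0 < R) (hf : C1AwayFromZero f) (hcond : CondA3 θ m f)
    (hsign : ∀ p ≠ 0, f p = σ * |f p|) (hu : IsSolution f u R)
    (hL : IsLUB (oscillationSet u R) L) (hQ : 0 < Q) (hLQ : L ≤ Q) (h0 : gradient u 0 ≠ 0) :
    ∃ (p : En n) (η H : ℝ), p ≠ 0 ∧ 0 < η ∧ η ≤ 1 ∧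
      Real.log (1 + ‖gradient u 0‖ ^ 2) ≤ η ^ (1 / θ) * (3 * Real.log (1 + ‖p‖ ^ 2)) ∧
      1 / (3 * (Q + 2 * L)) ≤ H ∧ H ≤ 1 / (3 * Q) ∧
      2 * |f p| ^ 2 / (n * Real.log (1 + ‖p‖ ^ 2)) +
          H * |f p| * ((2 * θ * ‖p‖ ^ 2 / Real.log (1 + ‖p‖ ^ 2) - 1) / √(1 + ‖p‖ ^ 2)) ≤
        2 * (1 / θ) * (R / 2 * η)⁻¹ * (1 + 2 * θ / Real.log (1 + ‖p‖ ^ 2)) * |f p|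
            * (‖p‖ / √(1 + ‖p‖ ^ 2))
          + (8 * (1 / θ) ^ 2 + 1 / θ * (2 * n + 4)) * (R / 2 * η)⁻¹ ^ 2 := by
  have hL0 := nonneg_of_isLUB hR hL
  -- The sign in `φ = c + σ u` makes the terms in `H * f` depend only on `|f|`; `φ` lies in `[Q, Q +
  -- 2 L]`.
  set c := Q + L - σ * u 0 with hc
  have habs : |σ| = 1 := by
    rw [← sq_eq_sq₀ (abs_nonneg _) zero_le_one, sq_abs, hσ, one_pow]
  have hφ : ∀ x ∈ ballR n R, Q ≤ c + σ * u x ∧ c + σ * u x ≤ Q + 2 * L := by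
    intro x hx
    have h1 : |σ * (u x - u 0)| ≤ L := by
      rw [abs_mul, habs, one_mul]
      exact abs_sub_le_of_isLUB hR hL hx
    have := abs_le.1 h1
    constructor <;> linarith
  obtain ⟨x, p, a, ζ, η, τ, hx, hp, hη, hη1, hle, hζ, ha, hineq, hτ, -, -⟩ :=
    hu.exists_point_log_log hR (fun p hp => hf.differentiableAt hp) h0 (k := 1 / θ) (by positivity)
      (h₁ := fun s => -(1 / 3 * σ / (c + σ * s))) (h₂ := fun s => 1 / 3 * σ ^ 2 / (c + σ * s) ^ 2)
      (fun y hy => hasDerivAt_neg_mul_log (hQ.trans_le (hφ y hy).1))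
      (fun y hy => hasDerivAt_neg_div (hQ.trans_le (hφ y hy).1))
  obtain ⟨hφQ, hφ3⟩ := hφ x hx
  have hφ0 : c + σ * u 0 ≤ 2 * (c + σ * u x) := by rw [hc] at hφQ ⊢; linarith
  have hexp := exp_neg_mul_log_le (β := 1 / 3) (by norm_num) (by norm_num) (hQ.trans_le hφQ)
    (hQ.trans_le (hφ 0 (Metric.mem_ball_self hR)).1) hφ0
  set φ := c + σ * u x
  have hφpos : 0 < φ := hQ.trans_le hφQ
  have hn := natCast_pos_of_ne_zero hp
  have hz := log_one_add_pos (s := ‖p‖ ^ 2) (by positivity)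
  have hgrad := hcond.inner_gradient_eq hsign hp ζ
  have hfs := hsign p hp
  refine ⟨p, η, 1 / (3 * φ), hp, hη, hη1, ?_, ?_, ?_, ?_⟩
  · have : Real.log (1 + ‖gradient u 0‖ ^ 2) * Real.exp (-(1 / 3 * Real.log (c + σ * u 0))) ≤
        η ^ (1 / θ) * (3 * Real.log (1 + ‖p‖ ^ 2))
          * Real.exp (-(1 / 3 * Real.log (c + σ * u 0))) := by
      refine hle.trans ?_
      calc _ ≤ η ^ (1 / θ) * (Real.log (1 + ‖p‖ ^ 2)
            * (3 * Real.exp (-(1 / 3 * Real.log (c + σ * u 0))))) := by gcongr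
        _ = _ := by ring
    exact le_of_mul_le_mul_right this (Real.exp_pos _)
  · gcongr
  · gcongr
  set z := Real.log (1 + ‖p‖ ^ 2)
  set δ := (R / 2 * η)⁻¹ with hδ
  have hδpos : 0 < δ := by positivity
  have hW : 0 < √(1 + ‖p‖ ^ 2) := Real.sqrt_pos.2 (by positivity)
  have hW2 : √(1 + ‖p‖ ^ 2) ^ 2 = 1 + ‖p‖ ^ 2 := Real.sq_sqrt (by positivity)
  have hTle := (graphForm_sub_smul_bounds p a (-(1 / 3 * σ / φ))).1
  rw [← hζ] at hTle
  have hpin : inner ℝ p ζ = inner ℝ p a + 1 / (3 * φ) * σ * ‖p‖ ^ 2 := by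
    rw [hζ, inner_sub_right, real_inner_smul_right, real_inner_self_eq_norm_sq]
    field_simp
    ring
  have e0 : (-(1 / 3 * σ / φ)) ^ 2 = (1 / (3 * φ)) ^ 2 := by
    calc _ = σ ^ 2 * (1 / (3 * φ)) ^ 2 := by field_simp
      _ = _ := by rw [hσ, one_mul]
  -- The weight `1 / 3` makes `h'' = 3 H²`, which exceeds the `2 H²` lost in `graphForm p ζ`.
  have e0' : 1 / 3 * σ ^ 2 / φ ^ 2 = 3 * (1 / (3 * φ)) ^ 2 := by rw [hσ]; field_simp
  have e0'' : -(1 / 3 * σ / φ) = -(1 / (3 * φ) * σ) := by field_simp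
  rw [e0] at hTle
  rw [e0', e0'', hgrad] at hineq
  set H := 1 / (3 * φ)
  set W := √(1 + ‖p‖ ^ 2)
  set F := |f p|
  set q := ‖p‖ ^ 2 / (1 + ‖p‖ ^ 2) with hq
  have hqpos : 0 < q := by positivity
  have hF0 : 0 ≤ F := abs_nonneg _
  have e1 : 2 * F ^ 2 / (n * z) ≤ 2 * τ / z := by
    rw [← div_div]
    gcongr ?_ / _
    rw [div_le_iff₀ hn, sq_abs]; linarith
  have e2 : W * (2 * θ / z * f p * (inner ℝ p ζ / (1 + ‖p‖ ^ 2))) + f p * inner ℝ p ζ / W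
      + -(H * σ) * (W * f p)
      = (1 + 2 * θ / z) * F * (σ * (inner ℝ p a / W))
        + H * F * ((2 * θ * ‖p‖ ^ 2 / z - 1) / W) := by
    have hv : ‖p‖ ^ 2 = W ^ 2 - 1 := by linarith
    rw [hpin, ← hW2, hfs, hv]
    field_simp
    ring_nf
    simp only [hσ]
    ring
  have e3 : -(2 * (1 / θ) * δ * (1 + 2 * θ / z) * F * (‖p‖ / W))
      ≤ (1 + 2 * θ / z) * F * (σ * (inner ℝ p a / W)) := by
    refine (neg_le_neg ?_).trans (neg_abs_le _)
    rw [abs_mul, abs_mul, abs_mul, habs, one_mul, abs_of_pos (show 0 < 1 + 2 * θ / z by positivity),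
      abs_of_nonneg hF0, abs_div, abs_of_pos hW]
    calc (1 + 2 * θ / z) * F * (|inner ℝ p a| / W)
        ≤ (1 + 2 * θ / z) * F * (‖p‖ * (2 * (1 / θ) * δ) / W) := by
          gcongr
          exact (abs_real_inner_le_norm p a).trans (by gcongr)
      _ = _ := by ring
  have e4 : ‖a‖ ^ 2 ≤ 4 * (1 / θ) ^ 2 * δ ^ 2 := by
    calc ‖a‖ ^ 2 ≤ (2 * (1 / θ) * δ) ^ 2 := by gcongr
      _ = _ := by ring
  have e5 : 0 ≤ H ^ 2 * q := by positivity
  linarith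

end ExactLogGrowth

/-! ### Case (c): from the inequality to the bound. -/

noncomputable section ExactLogGrowthBound

variable {n : ℕ} {R : ℝ}

/-- Small values: the zeroth order term dominates. -/
lemma rpow_bound_of_small {n' m k θ δ D z X Z s : ℝ} (hn : 0 < n') (hm : 0 < m) (hk : 0 < k)
    (hθ : 0 < θ) (hθ1 : θ ≤ 1) (hδ : 0 < δ) (hD : 0 ≤ D) (hz : 0 < z) (hX : 0 < X) (hzZ : z ≤ Z)
    (hZ : 1 ≤ Z) (hs : s ≤ √z)
    (h : m ^ 2 * X ^ 2 / (n' * z) ≤ 2 * k * δ * (1 + 2 * θ / z) * (m * X) * s + D * δ ^ 2) :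
    X ≤ Z * ((2 * k * m * (Z + 2) + D) / (m ^ 2 / n') + 1) * δ := by
  have hsz : 0 < √z := Real.sqrt_pos.2 hz
  have hsz2 : √z ^ 2 = z := Real.sq_sqrt hz.le
  set Y := X / √z with hY
  have hXY : X = Y * √z := by rw [hY]; field_simp
  have hY0 : 0 < Y := by positivity
  have hquad : m ^ 2 / n' * Y ^ 2 ≤ 2 * k * m * (Z + 2) * δ * Y + D * δ ^ 2 := by
    have e1 : m ^ 2 / n' * Y ^ 2 = m ^ 2 * X ^ 2 / (n' * z) := by
      rw [hY, div_pow, hsz2]; field_simp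
    have e2 : 2 * k * δ * (1 + 2 * θ / z) * (m * X) * s ≤ 2 * k * m * (Z + 2) * δ * Y := by
      calc 2 * k * δ * (1 + 2 * θ / z) * (m * X) * s
          ≤ 2 * k * δ * (1 + 2 * θ / z) * (m * X) * √z := by gcongr
        _ = 2 * k * m * ((1 + 2 * θ / z) * √z ^ 2) * δ * Y := by rw [hXY]; ring
        _ = 2 * k * m * (z + 2 * θ) * δ * Y := by rw [hsz2]; field_simp
        _ ≤ _ := by gcongr; linarith
    linarith
  have hYM := le_mul_of_quadratic_le (by positivity) (by positivity) hD hδ.le hquad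
  have hszZ : √z ≤ Z := Real.sqrt_le_iff.2 ⟨by linarith, by nlinarith⟩
  rw [hXY]
  calc Y * √z ≤ ((2 * k * m * (Z + 2) + D) / (m ^ 2 / n') + 1) * δ * Z := by gcongr
    _ = _ := by ring

/-- The bound `logᶿ(1 + |p|²) ≤ A √(L + 1) δ` at the maximum point. -/
lemma rpow_le_of_condA3_inequality {n' m θ L H Λ A v F W z δ D : ℝ} (hn : 0 < n') (hm : 0 < m)
    (hθ : 0 < θ) (hθ1 : θ ≤ 1) (hL : 0 ≤ L) (hδ : 0 < δ) (hD : 0 ≤ D) (hv : 0 < v)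
    (hΛ : Λ = n' * (2 / θ) / m + 1)
    (hA : A = (6 * (1 / θ) * m + D) / √(m ^ 2 * (m * θ / (6 * (Λ + 2))) / (6 * n')) + 1
      + 2 / θ * ((2 * (1 / θ) * m * (2 / θ + 2) + D) / (m ^ 2 / n') + 1))
    (hz : z = Real.log (1 + v)) (hW : W = √(1 + v)) (hF : F = m * z ^ θ)
    (hH : 1 / (3 * (Λ * (L + 1) + 2 * L)) ≤ H) (hH' : H ≤ 1 / (3 * (Λ * (L + 1))))
    (h : 2 * F ^ 2 / (n' * z) + H * F * ((2 * θ * v / z - 1) / W) ≤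
      2 * (1 / θ) * δ * (1 + 2 * θ / z) * F * (√v / W) + D * δ ^ 2) :
    z ^ θ ≤ A * √(L + 1) * δ := by
  have hzpos : 0 < z := by rw [hz]; exact log_one_add_pos hv
  have hzv : z ≤ v := by rw [hz]; exact log_one_add_le hv.le
  have hexpz : Real.exp z = 1 + v := by rw [hz, Real.exp_log (by positivity)]
  have hW2 : W ^ 2 = 1 + v := by rw [hW]; exact Real.sq_sqrt (by positivity)
  have hW1 : 1 ≤ W := by rw [hW]; exact Real.one_le_sqrt.2 (by linarith)
  have hWpos : 0 < W := by linarith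
  have hvW : √v / W ≤ 1 := by
    rw [div_le_one hWpos, hW]; exact Real.sqrt_le_sqrt (by linarith)
  have hvz : √v / W ≤ √z := by
    rw [hW, ← Real.sqrt_div hv.le]
    refine Real.sqrt_le_sqrt ?_
    have := Real.one_sub_inv_le_log_of_pos (show 0 < 1 + v by linarith)
    rw [← hz] at this
    refine le_trans (le_of_eq ?_) this
    field_simp
    ring
  have hZ2 : 2 ≤ 2 / θ := by rw [le_div_iff₀ hθ]; linarith
  have hΛ1 : 1 ≤ Λ := by
    have : 0 ≤ n' * (2 / θ) / m := by positivity
    rw [hΛ]; linarith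
  have hN : 1 ≤ L + 1 := by linarith
  have hsN : 1 ≤ √(L + 1) := Real.one_le_sqrt.2 hN
  set X := z ^ θ with hX
  have hXpos : 0 < X := by positivity
  have hHpos : 0 < H := lt_of_lt_of_le (by positivity) hH
  have hFpos : 0 < F := by rw [hF]; positivity
  have hM1 : 0 ≤ (6 * (1 / θ) * m + D) / √(m ^ 2 * (m * θ / (6 * (Λ + 2))) / (6 * n')) + 1 := by
    positivity
  have hM2 : 0 ≤ 2 / θ * ((2 * (1 / θ) * m * (2 / θ + 2) + D) / (m ^ 2 / n') + 1) := by positivity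
  -- Above `2 / θ` the bracket `2 θ v / z - 1` is positive and of order `θ v / z`; below, it may be
  -- negative but is at least `-1`.
  rcases le_total z (2 / θ) with hzZ | hzZ
  · have hzX : z ≤ 2 / θ * X := by
      rcases le_total z 1 with h1 | h1
      · have : z ≤ X := by
          simpa using Real.rpow_le_rpow_of_exponent_ge hzpos h1 hθ1
        nlinarith
      · have : 1 ≤ X := Real.one_le_rpow h1 hθ.le
        exact hzZ.trans (le_mul_of_one_le_right (by positivity) this)
    have hbad : -(F ^ 2 / (n' * z)) ≤ H * F * ((2 * θ * v / z - 1) / W) := by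
      have i1 : -1 ≤ (2 * θ * v / z - 1) / W := by
        rw [le_div_iff₀ hWpos]
        have : 0 ≤ 2 * θ * v / z := by positivity
        linarith
      -- The definition of `Λ` makes `H` small enough for half of the `f²` term to absorb the
      -- negative part.
      have i2 : H * F ≤ F ^ 2 / (n' * z) := by
        rw [pow_two, mul_div_right_comm]
        gcongr
        rw [le_div_iff₀ (by positivity), hF]
        have hHΛ : H * Λ ≤ 1 := by
          have : H * (3 * (Λ * (L + 1))) ≤ 1 := by
            rwa [← le_div_iff₀ (by positivity)]
          have hΛL : 0 ≤ Λ * L := by positivity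
          refine le_trans ?_ this
          gcongr
          linarith
        have hnZ : n' * (2 / θ) ≤ Λ * m := by
          have : Λ * m = n' * (2 / θ) + m := by rw [hΛ]; field_simp
          linarith
        calc H * (n' * z) ≤ H * (n' * (2 / θ * X)) := by gcongr
          _ = H * (n' * (2 / θ)) * X := by ring
          _ ≤ H * (Λ * m) * X := by gcongr
          _ = H * Λ * (m * X) := by ring
          _ ≤ 1 * (m * X) := by gcongr
          _ = _ := one_mul _
      have i3 := mul_le_mul_of_nonneg_left i1 (show 0 ≤ H * F by positivity)
      linarith
    have hsmall := rpow_bound_of_small hn hm (show 0 < 1 / θ by positivity) hθ hθ1 hδ hD hzpos hXpos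
      hzZ (by linarith) hvz (by
        rw [← hF]
        have : 2 * F ^ 2 / (n' * z) = m ^ 2 * X ^ 2 / (n' * z) + F ^ 2 / (n' * z) := by
          rw [hF]; ring
        linarith)
    refine hsmall.trans ?_
    gcongr ?_ * δ
    refine le_trans (b := A) (by rw [hA]; linarith) (le_mul_of_one_le_right ?_ hsN)
    rw [hA]
    linarith
  · have hz2 : 2 ≤ z := hZ2.trans hzZ
    have hXz : X ≤ z := by
      simpa using Real.rpow_le_rpow_of_exponent_le (show 1 ≤ z by linarith) hθ1
    -- The cubic term of the series of `exp (z / 2) = W`.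
    have hE : z ^ 3 ≤ 48 * W := by
      have h1 := Real.pow_div_factorial_le_exp (z / 2) (by positivity) 3
      rw [Real.exp_half, hexpz, ← hW] at h1
      norm_num [Nat.factorial] at h1
      linarith
    have hgood : m * θ / (6 * (Λ + 2)) * X * W / (z * (L + 1)) ≤
        H * F * ((2 * θ * v / z - 1) / W) := by
      have hquad : z ^ 2 ≤ 2 * v := by
        have := Real.quadratic_le_exp_of_nonneg hzpos.le
        rw [hexpz] at this
        linarith
      have hθz : 2 ≤ z * θ := by rwa [div_le_iff₀ hθ] at hzZ
      have i1 : θ * W / (2 * z) ≤ (2 * θ * v / z - 1) / W := by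
        rw [div_le_div_iff₀ (by positivity) hWpos]
        have h1 : θ * W * W = θ * (1 + v) := by rw [mul_assoc, ← pow_two, hW2]
        have h2 : (2 * θ * v / z - 1) * (2 * z) = 4 * θ * v - 2 * z := by field_simp; ring
        have h3 : 2 * z ≤ θ * (2 * v) := by
          calc 2 * z ≤ z * θ * z := by gcongr
            _ = θ * z ^ 2 := by ring
            _ ≤ _ := by gcongr
        have h4 : θ * 1 ≤ θ * v := by gcongr; linarith
        rw [h1, h2]
        linarith
      have i2 : 1 / (3 * (Λ + 2) * (L + 1)) ≤ H := by
        refine le_trans (one_div_le_one_div_of_le (by positivity) ?_) hH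
        linarith
      calc m * θ / (6 * (Λ + 2)) * X * W / (z * (L + 1))
          = 1 / (3 * (Λ + 2) * (L + 1)) * F * (θ * W / (2 * z)) := by
            rw [hF]; field_simp; norm_num
        _ ≤ _ := by gcongr
    have hrhs : 2 * (1 / θ) * δ * (1 + 2 * θ / z) * F * (√v / W) ≤ 6 * (1 / θ) * m * δ * X := by
      have i1 : 1 + 2 * θ / z ≤ 3 := by
        have : 2 * θ / z ≤ 2 := by rw [div_le_iff₀ hzpos]; linarith
        linarith
      calc 2 * (1 / θ) * δ * (1 + 2 * θ / z) * F * (√v / W)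
          ≤ 2 * (1 / θ) * δ * 3 * F * 1 := by gcongr
        _ = _ := by rw [hF]; ring
    have hlarge := rpow_bound_of_large (E := W) (N := L + 1) (B := 6 * (1 / θ) * m)
      (c := m * θ / (6 * (Λ + 2))) hn hm (by positivity) (by positivity) hD hN hδ hzpos hXpos hXz hE
      (by
        have : 2 * F ^ 2 / (n' * z) = 2 * m ^ 2 * X ^ 2 / (n' * z) := by rw [hF]; ring
        linarith)
    refine hlarge.trans ?_
    gcongr
    rw [hA]
    linarith

/-- Interior gradient bound for right-hand sides of exact logarithmic growth. -/
theorem gradient_bound_of_condA3 (n : ℕ) (θ m : ℝ) (hθ : 0 < θ) (hθ1 : θ ≤ 1) (hm : 0 < m) :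
    ∃ C : ℝ, 0 < C ∧
      ∀ (R : ℝ) (f u : En n → ℝ) (L : ℝ), 0 < R → C1AwayFromZero f → CondA3 θ m f →
        IsSolution f u R → IsLUB (oscillationSet u R) L →
        ‖gradient u 0‖ ^ 2 ≤
          Real.exp (C * (L + 1) ^ (1 / (2 * θ)) / R ^ (1 / θ)) - 1 := by
  set Λ : ℝ := n * (2 / θ) / m + 1 with hΛ
  have hΛpos : 0 < Λ := by positivity
  set D : ℝ := 8 * (1 / θ) ^ 2 + 1 / θ * (2 * n + 4) with hD
  set A : ℝ := (6 * (1 / θ) * m + D) / √(m ^ 2 * (m * θ / (6 * (Λ + 2))) / (6 * n)) + 1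
      + 2 / θ * ((2 * (1 / θ) * m * (2 / θ + 2) + D) / (m ^ 2 / n) + 1) with hA
  have hApos : 0 < A := by positivity
  refine ⟨(2 * (2 / θ / m)) ^ (1 / θ) + (6 * A) ^ (1 / θ), by positivity,
    fun R f u L hR hf hcond hu hL => ?_⟩
  have hL0 := nonneg_of_isLUB hR hL
  by_cases h0 : gradient u 0 = 0
  · rw [h0, norm_zero, zero_pow two_ne_zero, sub_nonneg]
    exact Real.one_le_exp (by positivity)
  rw [norm_gradient_sq_eq_exp]
  gcongr
  have hn := natCast_pos_of_ne_zero h0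
  have hn1 : 0 < n := by exact_mod_cast hn
  have hNpow : 1 ≤ (L + 1) ^ (1 / (2 * θ)) := Real.one_le_rpow (by linarith) (by positivity)
  -- The punctured line is disconnected, so for `n = 1` no sign of `f` is available.
  rcases (Nat.succ_le_of_lt hn1).eq_or_lt with h1 | h2
  · obtain rfl : n = 1 := h1.symm
    refine (log_bound_of_condA3_one hθ hm hR hf hcond hu h0).trans ?_
    gcongr
    have : 0 ≤ (6 * A) ^ (1 / θ) := by positivity
    have : 0 ≤ (2 * (2 / θ / m)) ^ (1 / θ) := by positivity
    nlinarith
  · have hne : ∀ p ≠ 0, f p ≠ 0 := by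
      intro p hp hfp
      have hz := log_one_add_pos (s := ‖p‖ ^ 2) (by positivity)
      have := hcond p hp
      rw [hfp, abs_zero] at this
      have : 0 < m * Real.log (1 + ‖p‖ ^ 2) ^ θ := by positivity
      linarith
    obtain ⟨σ, hσ, hsign⟩ := exists_sign_of_ne_zero h2 hf.continuousOn hne
    have hΛ1 : 1 ≤ Λ := by
      have : 0 ≤ n * (2 / θ) / m := by positivity
      linarith
    obtain ⟨p, η, H, hp, hη, hη1, hle, hH, hH', hineq⟩ := exists_point_of_condA3 hθ hσ hR hf hcond
      hsign hu hL (Q := Λ * (L + 1)) (by positivity) (by nlinarith) h0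
    have hz := log_one_add_pos (s := ‖p‖ ^ 2) (by positivity)
    have hX := rpow_le_of_condA3_inequality (v := ‖p‖ ^ 2) (F := |f p|) hn hm hθ hθ1 hL0
      (show 0 < (R / 2 * η)⁻¹ by positivity) (show 0 ≤ D by positivity) (by positivity) hΛ hA rfl rfl
      (hcond p hp) hH hH' (by rwa [Real.sqrt_sq (norm_nonneg _)])
    have hX3 : (3 * Real.log (1 + ‖p‖ ^ 2)) ^ θ ≤ 3 * A * √(L + 1) * (R / 2 * η)⁻¹ := by
      rw [Real.mul_rpow (by norm_num) hz.le]
      have : (3 : ℝ) ^ θ ≤ 3 := by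
        simpa using Real.rpow_le_rpow_of_exponent_le (show (1 : ℝ) ≤ 3 by norm_num) hθ1
      calc (3 : ℝ) ^ θ * Real.log (1 + ‖p‖ ^ 2) ^ θ ≤ 3 * (A * √(L + 1) * (R / 2 * η)⁻¹) := by gcongr
        _ = _ := by ring
    have hfin := le_of_cutoff_rpow_le (log_one_add_pos (by positivity)).le (by positivity) hη hη1 hθ
      (by field_simp; rfl) (by positivity) hR hle hX3
    refine hfin.trans ?_
    have e : (2 * (3 * A * √(L + 1))) ^ (1 / θ) = (6 * A) ^ (1 / θ) * (L + 1) ^ (1 / (2 * θ)) := by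
      rw [show 2 * (3 * A * √(L + 1)) = 6 * A * √(L + 1) by ring,
        Real.mul_rpow (by positivity) (Real.sqrt_nonneg _), Real.sqrt_eq_rpow,
        ← Real.rpow_mul (by linarith)]
      congr 2
      field_simp
    rw [e]
    gcongr
    have : 0 ≤ (2 * (2 / θ / m)) ^ (1 / θ) := by positivity
    linarith

end ExactLogGrowthBound

theorem theorem1 (n : ℕ) :
    -- (a)
    (∀ θ m₁ m₂ : ℝ, 0 < θ → 0 < m₁ → 0 < m₂ →
      ∃ C : ℝ, 0 < C ∧
        ∀ (R : ℝ) (f u : En n → ℝ), 0 < R → C1AwayFromZero f → CondA1 θ m₁ m₂ f →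
          IsSolution f u R →
          ‖gradient u 0‖ ≤ C / R ^ (1 / θ)) ∧
    -- (b)
    (∀ θ m₁ m₂ m₃ : ℝ, 1 < θ → 0 < m₁ → 0 < m₂ → 0 < m₃ →
      ∃ C : ℝ, 0 < C ∧
        ∀ (R : ℝ) (f u : En n → ℝ), 0 < R → C1AwayFromZero f → CondA2 θ m₁ m₂ m₃ f →
          IsSolution f u R →
          ‖gradient u 0‖ ^ 2 ≤
            max (Real.exp (C / R ^ (1 / (θ - 1))) - 1) (C / R ^ (2 / (2 * θ - 1)))) ∧
    -- (c)
    (∀ θ m₁ : ℝ, 0 < θ → θ ≤ 1 → 0 < m₁ →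
      ∃ C₁ : ℝ, 0 < C₁ ∧ ∀ η : ℝ, 0 < η → η < 1 → ∃ C₂ : ℝ, 0 < C₂ ∧
        ∀ (R : ℝ) (f u : En n → ℝ) (L : ℝ), 0 < R → C1AwayFromZero f → CondA3 θ m₁ f →
          IsSolution f u R → IsLUB (oscillationSet u R) L →
          ‖gradient u 0‖ ^ 2 ≤
            max (Real.exp (C₁ * (L + 1) ^ (1 / (2 * θ)) / R ^ (1 / θ)) - 1)
              (Real.exp (C₂ * (L + 1) ^ (1 / (1 - η)) / R ^ (2 / (1 - η))) - 1)) ∧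
    -- (d)
    (∀ m₁ m₂ : ℝ, 0 < m₁ → 0 < m₂ →
      ∃ C : ℝ, 0 < C ∧
        ∀ (R : ℝ) (f u : En n → ℝ) (L : ℝ), 0 < R → C1AwayFromZero f → CondA4 m₁ m₂ f →
          IsSolution f u R → IsLUB (oscillationSet u R) L →
          ‖gradient u 0‖ ^ 2 ≤
            max (Real.exp (C * (L + 1) ^ 2 / R ^ 2) - 1)
              (Real.exp (C * (L + 1) ^ 2 / R ^ ((2 : ℝ) / 3)) - 1)) ∧
    -- (e)
    (∃ C : ℝ, 0 < C ∧
      ∀ (R : ℝ) (u : En n → ℝ) (L : ℝ), 0 < R →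
        IsSolution (fun _ => 0) u R → IsLUB (oscillationSet u R) L →
        ‖gradient u 0‖ ^ 2 ≤
          max (Real.exp (C * L ^ 2 / R ^ 2) - 1) (Real.exp (C * L / R) - 1)) := by
  refine ⟨gradient_bound_of_condA1 n, fun θ m₁ m₂ m₃ hθ hm₁ hm₂ _ =>
    gradient_bound_of_condA2 n θ m₁ m₂ m₃ hθ hm₁ hm₂, ?_, gradient_bound_of_condA4 n,
    gradient_bound_of_zero n⟩
  intro θ m₁ hθ hθ1 hm₁
  obtain ⟨C, hC, h⟩ := gradient_bound_of_condA3 n θ m₁ hθ hθ1 hm₁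
  -- The first member of the maximum is already a bound, so the second constant is arbitrary.
  exact ⟨C, hC, fun η _ _ => ⟨1, one_pos, fun R f u L hR hf hcond hu hL =>
    le_max_of_le_left (h R f u L hR hf hcond hu hL)⟩⟩
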